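/- Let $m,n\ge 0$, let $\mathbb F=\mathbb C(q)$, and choose a Borel subalgebra of $\mathfrak{gl}_{m|n}$ containing the diagonal Cartan subalgebra, that is, an ordering $v_1,\dots,v_{m+n}$ of the standard homogeneous basis of $\mathbb C^{m|n}$. Let $[a]\in\{0,1\}$ be the parity of $v_a$, let $(\mathcal E_a,\mathcal E_b)=(-1)^{[a]}\delta_{ab}$ be the form on weights, and $\alpha_i=\mathcal E_i-\mathcal E_{i+1}$ the simple roots. Let $U_q(\mathbb F)$ be the quantum general linear supergroup of this root datum, with generators $K_a^{\pm1}$, $e_i$, $f_i$ and with $k_i=K_iK_{i+1}^{-1}$ and $$\Delta(K_a)=K_a\otimes K_a,\qquad \Delta(e_i)=e_i\otimes k_i+1\otimes e_i,\qquad \Delta(f_i)=f_i\otimes 1+k_i^{-1}\otimes f_i .$$ Let $V_q$ be its natural module, with basis $v_1,\dots,v_{m+n}$, where $K_a$ acts by $q^{(-1)^{[a]}E_{aa}}$. Let $\tau$ be the graded flip of $V_q\otimes V_q$. (1) There is exactly one operator $R$ on $V_q\otimes V_q$ such that $R=K\Theta$ and $R\,\Delta(x)=\Delta^{\mathrm{op}}(x)R$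 on $V_q\otimes V_q$ for all $x\in U_q(\mathbb F)$, where $K=q^{\sum_a(-1)^{[a]}E_{aa}\otimes E_{aa}}$ and $\Theta$ is the action of an element of $1\otimes 1+\sum_{\beta>0}U^+_\beta\otimes U^-_{-\beta}$ (here $U^{+}$ and $U^-$ are generated by the $e_i$ and by the $f_i$ respectively). This is the action $R_{V_q,V_q}$ of the $R$-matrix of $U_q(\mathbb F)$, and $c=c_{V_q,V_q}=\tau\circ R_{V_q,V_q}$ is the braiding. (2) There are idempotent $U_q(\mathbb F)$-endomorphisms $P[s]$, $P[a]$ of $V_q\otimes V_q$ with $P[s]+P[a]=1$ and $P[s]P[a]=P[a]P[s]=0$, whose images are simple or zero and have the dimensions $\binom{m+1}2+mn+\binom n2$ and $\binom m2+mn+\binom{n+1}2$ of the super-symmetric and the super-exterior square of $\mathbb C^{m|n}$, such that $$c=q\,P[s]-q^{-1}P[a].$$ In particular $(c-q)(c+q^{-1})=0$. (3) For every $r\ge 0$ there is a representation $\nu_r$ of the braid group $B_r$ on $V_q^{\otimes r}$ with $$\nu_r(X_i)=\mathrm{id}^{\otimes(r-i-1)}\otimes c\otimes \mathrm{id}^{\otimes(i-1)},\qquad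 1\le i\le r-1,$$ where $X_1,\dots,X_{r-1}$ are the standard generators. It factors through the Hecke algebra $H_r(q)$, which is the quotient of the group algebra $\mathbb F B_r$ by the two-sided ideal generated by the elements $X_i-X_i^{-1}-(q-q^{-1})$, $1\le i\le r-1$. -/

import Mathlib

set_option linter.unusedSimpArgs false
set_option linter.unusedVariables false

open scoped TensorProduct

noncomputable section

namespace QGL

/-- The ground field `ℂ(q)`. -/
abbrev F : Type := RatFunc ℂ

/-- The indeterminate `q`. -/
def q : F := RatFunc.X

/-- The Koszul sign `(-1)^(a b)`. -/
def koszul (a b : ZMod 2) : F := if a = 1 ∧ b = 1 then -1 else 1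

section RootDatum

variable {N : ℕ}

/-- Position `i` of the ordered basis, for a simple root `α_i = ℰ_i - ℰ_{i+1}`. -/
def lo (i : Fin (N - 1)) : Fin N := ⟨i, by omega⟩

/-- Position `i + 1` of the ordered basis, for a simple root `α_i = ℰ_i - ℰ_{i+1}`. -/
def hi (i : Fin (N - 1)) : Fin N := ⟨i + 1, by omega⟩

variable (p : Fin N → ZMod 2)

/-- `(ℰ_a, ℰ_a) = (-1)^[a]`. -/
def sgn (a : Fin N) : ℤ := if p a = 0 then 1 else -1

/-- The form `(ℰ_a, ℰ_b) = (-1)^[a] δ_{ab}` on the weights. -/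
def form (a b : Fin N) : ℤ := if a = b then sgn p a else 0

/-- `(ℰ_a, α_i)`. -/
def formRoot (a : Fin N) (i : Fin (N - 1)) : ℤ := form p a (lo i) - form p a (hi i)

/-- `(α_i, α_j)`. -/
def rootForm (i j : Fin (N - 1)) : ℤ := formRoot p (lo i) j - formRoot p (hi i) j

/-- The parity of the simple root `α_i`, which is the parity of `e_i` and of `f_i`. -/
def deg (i : Fin (N - 1)) : ZMod 2 := p (lo i) + p (hi i)

/-- `d_i = (α_i, α_i)/2` for even `α_i`, and `d_i = 1` for odd (isotropic) `α_i`. -/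
def dd (i : Fin (N - 1)) : ℤ := if deg p i = 0 then sgn p (lo i) else 1

end RootDatum

/-- The generators `e_i`, `f_i`, `K_a`, `K_a⁻¹`. -/
inductive Gen (N : ℕ) : Type
  | e (i : Fin (N - 1))
  | f (i : Fin (N - 1))
  | K (a : Fin N)
  | Kinv (a : Fin N)

/-- The `c`-commutator `x y - c y x`. -/
def qbr {A : Type} [Ring A] [Algebra F A] (c : F) (x y : A) : A := x * y - c • (y * x)

section Quantum

variable {N : ℕ} (p : Fin N → ZMod 2)

/-- A Serre-type relation set, for a family `x` of elements of an algebra (the `e_i` or the `f_i`).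
Each left-hand side that vanishes is an iterated quantum adjoint action
`Ad_{x_i} y = x_i y - (-1)^([x_i][y]) q^(α_i, wt y) y x_i`. -/
inductive SerreRel {A : Type} [Ring A] [Algebra F A] (x : Fin (N - 1) → A) : A → Prop
  /-- `x_i² = 0` for odd `α_i`. -/
  | odd (i) : deg p i = 1 → SerreRel x (x i * x i)
  /-- `Ad_{x_i} x_j = 0` for `|i - j| > 1`. -/
  | far (i j : Fin (N - 1)) : ((i : ℕ) + 1 < j ∨ (j : ℕ) + 1 < i) →
      SerreRel x (qbr (koszul (deg p i) (deg p j)) (x i) (x j))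
  /-- `Ad_{x_i}² x_j = 0` for `|i - j| = 1` and even `α_i`. -/
  | near (i j : Fin (N - 1)) : ((i : ℕ) + 1 = j ∨ (j : ℕ) + 1 = i) → deg p i = 0 →
      SerreRel x (qbr (q ^ (rootForm p i i + rootForm p i j)) (x i)
        (qbr (q ^ rootForm p i j) (x i) (x j)))
  /-- The higher order relation `Ad_{x_s} Ad_{x_r} Ad_{x_s} x_t = 0`
  for consecutive `r, s, t` with `α_s` odd. -/
  | higher (r s t : Fin (N - 1)) : (r : ℕ) + 1 = s → (s : ℕ) + 1 = t → deg p s = 1 →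
      SerreRel x
        (qbr (koszul (deg p s) (deg p r + deg p s + deg p t)) (x s)
          (qbr (koszul (deg p r) (deg p s + deg p t) * q ^ rootForm p r s) (x r)
            (qbr (koszul (deg p s) (deg p t) * q ^ rootForm p s t) (x s) (x t))))

/-- The defining relations of `U_q(gl_{m|n})`, for generators `e i`, `f i`, `K a`, `K' a = (K a)⁻¹`
in an algebra: the elements which are set to zero. -/
inductive DefRel {A : Type} [Ring A] [Algebra F A] (g : Gen N → A) : A → Prop
  | K_comm (a b) : DefRel g (g (.K a) * g (.K b) - g (.K b) * g (.K a))
  | K_Kinv (a) : DefRel g (g (.K a) * g (.Kinv a) - 1)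
  | Kinv_K (a) : DefRel g (g (.Kinv a) * g (.K a) - 1)
  | K_e (a i) : DefRel g
      (g (.K a) * g (.e i) * g (.Kinv a) - (q ^ formRoot p a i) • g (.e i))
  | K_f (a i) : DefRel g
      (g (.K a) * g (.f i) * g (.Kinv a) - (q ^ (-formRoot p a i)) • g (.f i))
  | e_f (i j) : i ≠ j → DefRel g (qbr (koszul (deg p i) (deg p j)) (g (.e i)) (g (.f j)))
  | e_f_same (i) : DefRel g (qbr (koszul (deg p i) (deg p i)) (g (.e i)) (g (.f i)) -
      (q ^ dd p i - q ^ (-dd p i))⁻¹ •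
        (g (.K (lo i)) * g (.Kinv (hi i)) - g (.Kinv (lo i)) * g (.K (hi i))))
  | serre_e (y) : SerreRel p (fun i => g (.e i)) y → DefRel g y
  | serre_f (y) : SerreRel p (fun i => g (.f i)) y → DefRel g y

theorem serreRel_map {A B : Type} [Ring A] [Algebra F A] [Ring B] [Algebra F B] (φ : A →ₐ[F] B)
    {x : Fin (N - 1) → A} {x' : Fin (N - 1) → B} (hx : ∀ i, φ (x i) = x' i) {y : A}
    (h : SerreRel p x y) : SerreRel p x' (φ y) := by
  cases h with
  | odd i h => simpa [hx] using SerreRel.odd (p := p) (x := x') i h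
  | far i j h => simpa [hx, qbr] using SerreRel.far (p := p) (x := x') i j h
  | near i j h h' => simpa [hx, qbr] using SerreRel.near (p := p) (x := x') i j h h'
  | higher r s t h h' h'' =>
    simpa [hx, qbr] using SerreRel.higher (p := p) (x := x') r s t h h' h''

theorem defRel_map {A B : Type} [Ring A] [Algebra F A] [Ring B] [Algebra F B] (φ : A →ₐ[F] B)
    {g : Gen N → A} {g' : Gen N → B} (hg : ∀ x, φ (g x) = g' x) {y : A}
    (h : DefRel p g y) : DefRel p g' (φ y) := by
  cases h with
  | K_comm a b => simpa [hg] using DefRel.K_comm (p := p) (g := g') a b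
  | K_Kinv a => simpa [hg] using DefRel.K_Kinv (p := p) (g := g') a
  | Kinv_K a => simpa [hg] using DefRel.Kinv_K (p := p) (g := g') a
  | K_e a i => simpa [hg] using DefRel.K_e (p := p) (g := g') a i
  | K_f a i => simpa [hg] using DefRel.K_f (p := p) (g := g') a i
  | e_f i j h => simpa [hg, qbr] using DefRel.e_f (p := p) (g := g') i j h
  | e_f_same i => simpa [hg, qbr] using DefRel.e_f_same (p := p) (g := g') i
  | serre_e _ h => exact DefRel.serre_e _ (serreRel_map p φ (fun i => hg _) h)
  | serre_f _ h => exact DefRel.serre_f _ (serreRel_map p φ (fun i => hg _) h)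

/-- The quantum general linear supergroup over `ℂ(q)`, for the ordered homogeneous basis of
parities `p`: the algebra presented by the generators and the defining relations. -/
abbrev Uq : Type :=
  RingQuot (fun x y : FreeAlgebra F (Gen N) => DefRel p (FreeAlgebra.ι F) x ∧ y = 0)

/-- The generators as elements of `U_q`. -/
def gen (g : Gen N) : Uq p := RingQuot.mkAlgHom F _ (FreeAlgebra.ι F g)

/-- A `ℤ/2`-graded `U_q`-module structure on a vector space `W`. The grading is given by the parity
operator `w ↦ (-1)^[w] w`, with which even (odd) generators (anti)commute. -/
structure SuperModule (W : Type) [AddCommGroup W] [Module F W] where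
  /-- The action of the algebra. -/
  act : Uq p →ₐ[F] Module.End F W
  /-- The parity operator. -/
  par : Module.End F W
  par_sq : par * par = 1
  par_K (a : Fin N) : par * act (gen p (.K a)) = act (gen p (.K a)) * par
  par_e (i : Fin (N - 1)) :
    par * act (gen p (.e i)) = koszul 1 (deg p i) • (act (gen p (.e i)) * par)
  par_f (i : Fin (N - 1)) :
    par * act (gen p (.f i)) = koszul 1 (deg p i) • (act (gen p (.f i)) * par)

namespace SuperModule

variable {p}
variable {W W' : Type} [AddCommGroup W] [Module F W] [AddCommGroup W'] [Module F W']

/-- `k_i = K_i K_{i+1}⁻¹` on a module. -/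
def k (M : SuperModule p W) (i : Fin (N - 1)) : Module.End F W :=
  M.act (gen p (.K (lo i)) * gen p (.Kinv (hi i)))

/-- `k_i⁻¹` on a module. -/
def kinv (M : SuperModule p W) (i : Fin (N - 1)) : Module.End F W :=
  M.act (gen p (.Kinv (lo i)) * gen p (.K (hi i)))

/-- The action of the generators on `W ⊗ W'` through the comultiplication
`Δ(e_i) = e_i ⊗ k_i + 1 ⊗ e_i`, `Δ(f_i) = f_i ⊗ 1 + k_i⁻¹ ⊗ f_i`, `Δ(K_a^{±1}) = K_a^{±1} ⊗ K_a^{±1}`,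
with the sign rule `(x ⊗ y)(w ⊗ w') = (-1)^([y][w]) x w ⊗ y w'`. -/
def comulAct (M : SuperModule p W) (M' : SuperModule p W') :
    Gen N → Module.End F (W ⊗[F] W')
  | .e i => TensorProduct.map (M.act (gen p (.e i))) (M'.k i) +
      TensorProduct.map (M.par ^ (deg p i).val) (M'.act (gen p (.e i)))
  | .f i => TensorProduct.map (M.act (gen p (.f i))) LinearMap.id +
      TensorProduct.map (M.kinv i * M.par ^ (deg p i).val) (M'.act (gen p (.f i)))
  | .K a => TensorProduct.map (M.act (gen p (.K a))) (M'.act (gen p (.K a)))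
  | .Kinv a => TensorProduct.map (M.act (gen p (.Kinv a))) (M'.act (gen p (.Kinv a)))

/-- The graded flip `w ⊗ w' ↦ (-1)^([w][w']) w' ⊗ w`. The operator in front of the flip is
`1/2 (1 ⊗ 1 + π ⊗ 1 + 1 ⊗ π' - π ⊗ π')` for the parity operators `π`, `π'`; it is `-1` on
odd ⊗ odd and `1` on the other three homogeneous components. -/
def flip (M : SuperModule p W) (M' : SuperModule p W') : W ⊗[F] W' →ₗ[F] W' ⊗[F] W :=
  (TensorProduct.comm F W W').toLinearMap ∘ₗ
    ((2 : F)⁻¹ • (LinearMap.id + TensorProduct.map M.par LinearMap.id +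
      TensorProduct.map LinearMap.id M'.par - TensorProduct.map M.par M'.par))

/-- The type-one weight space of weight `∑ l_a ℰ_a`: `E_aa` acts by `l_a`, that is
`K_a = q^((-1)^[a] E_aa)` acts by `q^((-1)^[a] l_a)`. -/
def weightSpace (M : SuperModule p W) (l : Fin N → ℤ) : Submodule F W where
  carrier := {w | ∀ a, M.act (gen p (.K a)) w = (q ^ (sgn p a * l a)) • w}
  add_mem' := by
    intro x y hx hy a
    rw [map_add, hx a, hy a, smul_add]
  zero_mem' := by intro a; simp
  smul_mem' := by
    intro c x hx a
    rw [map_smul, hx a, smul_comm]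

/-- `κ` is the operator `q^(∑_a (-1)^[a] E_aa ⊗ E_aa)`: it acts by `q^(λ, μ)` on the tensor product
of the weight spaces of weights `λ` and `μ` (this determines `κ` if the modules are of type one, that
is, spanned by their type-one weight spaces). -/
def IsCartanFactor (M : SuperModule p W) (M' : SuperModule p W')
    (κ : Module.End F (W ⊗[F] W')) : Prop :=
  ∀ (l l' : Fin N → ℤ), ∀ w ∈ M.weightSpace l, ∀ w' ∈ M'.weightSpace l',
    κ (w ⊗ₜ w') = (q ^ (∑ a, sgn p a * (l a * l' a))) • (w ⊗ₜ[F] w')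

/-- The operator of `E ⊗ F` on `W ⊗ W'`, where `E = e_{i₁} e_{i₂} ⋯` and `F = f_{j₁} f_{j₂} ⋯`
for the lists `s = [i₁, i₂, …]` and `s' = [j₁, j₂, …]`. -/
def wordAct (M : SuperModule p W) (M' : SuperModule p W') (s s' : List (Fin (N - 1))) :
    Module.End F (W ⊗[F] W') :=
  TensorProduct.map
    (M.act (s.map fun i => gen p (.e i)).prod * M.par ^ ((s'.map (deg p)).sum).val)
    (M'.act (s'.map fun i => gen p (.f i)).prod)

/-- `Θ` is the operator of an element of `1 ⊗ 1 + ∑_{β > 0} U⁺_β ⊗ U⁻_{-β}`. -/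
def IsUnipotentFactor (M : SuperModule p W) (M' : SuperModule p W')
    (Θ : Module.End F (W ⊗[F] W')) : Prop :=
  Θ - 1 ∈ Submodule.span F
    {T | ∃ s s' : List (Fin (N - 1)), s ≠ [] ∧ s.Perm s' ∧ T = M.wordAct M' s s'}

/-- `R` is the `R`-matrix `R_{W, W'}`: it has the form `K Θ` of the universal `R`-matrix and
satisfies `R Δ(x) = Δᵒᵖ(x) R`, that is, `τ ∘ R : W ⊗ W' → W' ⊗ W` commutes with `U_q`. -/
def IsRMatrix (M : SuperModule p W) (M' : SuperModule p W')
    (R : Module.End F (W ⊗[F] W')) : Prop :=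
  (∃ κ Θ, M.IsCartanFactor M' κ ∧ M.IsUnipotentFactor M' Θ ∧ R = κ * Θ) ∧
  ∀ g : Gen N, (M.flip M' ∘ₗ R) ∘ₗ M.comulAct M' g = M'.comulAct M g ∘ₗ (M.flip M' ∘ₗ R)

/-- `L` is a `U_q`-submodule of `W ⊗ W'`. -/
def IsStable (M : SuperModule p W) (M' : SuperModule p W')
    (L : Submodule F (W ⊗[F] W')) : Prop :=
  ∀ g : Gen N, ∀ x ∈ L, M.comulAct M' g x ∈ L

end SuperModule

/-- The matrices of the generators on the natural module, in the ordered basis `v_1, …, v_N`: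
`e_i = E_{i,i+1}`, `f_i = E_{i+1,i}` up to the sign forced by the choice of the `d_i`, and
`K_a = q^((-1)^[a] E_aa)`. -/
def natGen : Gen N → Matrix (Fin N) (Fin N) F
  | .e i => Matrix.single (lo i) (hi i) 1
  | .f i => Matrix.single (hi i) (lo i) (if deg p i = 0 then 1 else (sgn p (lo i) : F))
  | .K a => Matrix.diagonal fun b => if b = a then q ^ sgn p a else 1
  | .Kinv a => Matrix.diagonal fun b => if b = a then q ^ (-sgn p a) else 1

theorem q_ne_zero : q ≠ 0 := RatFunc.X_ne_zero

theorem mul_mul_zero {A : Type} [Ring A] {x y : A} (h : x * y = 0) (z : A) :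
    x * (y * z) = 0 := by
  rw [← mul_assoc, h, zero_mul]

theorem qbr_near {A : Type} [Ring A] [Algebra F A] (c d : F) {x y : A} (h : x * x = 0)
    (h' : x * y = 0 ∨ y * x = 0) : qbr c x (qbr d x y) = 0 := by
  rcases h' with h' | h' <;>
    simp [qbr, mul_sub, sub_mul, mul_assoc, h, h', mul_mul_zero h, mul_mul_zero h']

theorem qbr_higher {A : Type} [Ring A] [Algebra F A] (c d k : F) {r s t : A} (h : s * s = 0)
    (h1 : r * t = 0) (h2 : t * r = 0)
    (h' : (t * s = 0 ∧ s * r = 0) ∨ (s * t = 0 ∧ r * s = 0)) :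
    qbr c s (qbr d r (qbr k s t)) = 0 := by
  rcases h' with ⟨h3, h4⟩ | ⟨h3, h4⟩ <;>
    simp [qbr, mul_sub, sub_mul, mul_assoc, h1, h2, h3, h4, mul_mul_zero h1,
      mul_mul_zero h3, mul_mul_zero h4]

theorem natGen_serre_e (y : Matrix (Fin N) (Fin N) F)
    (h : SerreRel p (fun i => natGen p (.e i)) y) : y = 0 := by
  have key : ∀ i j : Fin (N - 1), (i : ℕ) + 1 ≠ j → natGen p (.e i) * natGen p (.e j) = 0 := by
    intro i j h
    simp [natGen, lo, hi, h]
  cases h with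
  | odd i h => exact key i i (by omega)
  | far i j h => simp [qbr, key i j (by omega), key j i (by omega)]
  | near i j h hd =>
    refine qbr_near _ _ (key i i (by omega)) ?_
    rcases h with h | h
    · exact Or.inr (key j i (by omega))
    · exact Or.inl (key i j (by omega))
  | higher r s t h1 h2 hd =>
    exact qbr_higher _ _ _ (key s s (by omega)) (key r t (by omega)) (key t r (by omega))
      (Or.inl ⟨key t s (by omega), key s r (by omega)⟩)

theorem natGen_serre_f (y : Matrix (Fin N) (Fin N) F)
    (h : SerreRel p (fun i => natGen p (.f i)) y) : y = 0 := by
  have key : ∀ i j : Fin (N - 1), (i : ℕ) ≠ j + 1 → natGen p (.f i) * natGen p (.f j) = 0 := by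
    intro i j h
    simp [natGen, lo, hi, h]
  cases h with
  | odd i h => exact key i i (by omega)
  | far i j h => simp [qbr, key i j (by omega), key j i (by omega)]
  | near i j h hd =>
    refine qbr_near _ _ (key i i (by omega)) ?_
    rcases h with h | h
    · exact Or.inl (key i j (by omega))
    · exact Or.inr (key j i (by omega))
  | higher r s t h1 h2 hd =>
    exact qbr_higher _ _ _ (key s s (by omega)) (key r t (by omega)) (key t r (by omega))
      (Or.inr ⟨key s t (by omega), key r s (by omega)⟩)

theorem lo_ne_hi (i : Fin (N - 1)) : (lo i : Fin N) ≠ hi i := by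
  simp [lo, hi]

theorem natGen_K_single (a b c : Fin N) (x : F) :
    natGen p (.K a) * Matrix.single b c x * natGen p (.Kinv a) =
      (q ^ (form p a b - form p a c)) • Matrix.single b c x := by
  have hq := q_ne_zero
  ext i j
  simp only [natGen, Matrix.mul_diagonal, Matrix.diagonal_mul, Matrix.smul_apply, smul_eq_mul,
    Matrix.single_apply]
  by_cases h : b = i ∧ c = j
  · obtain ⟨rfl, rfl⟩ := h
    simp only [form, zpow_sub₀ hq]
    by_cases h1 : b = a <;> by_cases h2 : c = a <;>
      simp [h1, h2, Ne.symm] <;> field_simp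
  · simp [h]

theorem q_sub_inv_ne_zero : q - q⁻¹ ≠ 0 := by
  intro h
  have h1 : q * q = 1 := by
    have := congrArg (fun x => x * q) h
    simp only [sub_mul, inv_mul_cancel₀ q_ne_zero, zero_mul] at this
    exact sub_eq_zero.mp this
  have h2 : (Polynomial.X * Polynomial.X : Polynomial ℂ) = 1 := by
    apply RatFunc.algebraMap_injective ℂ
    simpa [q] using h1
  have h3 := congrArg Polynomial.natDegree h2
  simp at h3

/-- The matrices of the natural module satisfy the defining relations. -/
theorem natGen_rel (y : Matrix (Fin N) (Fin N) F) (h : DefRel p (natGen p) y) : y = 0 := by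
  have hq := q_ne_zero
  cases h with
  | K_comm a b => simp [natGen, Matrix.diagonal_mul_diagonal, mul_comm]
  | K_Kinv a =>
    rw [sub_eq_zero]
    ext i j
    by_cases h : i = j
    · subst h
      by_cases h1 : i = a <;> simp [natGen, h1, zpow_ne_zero _ hq]
    · simp [natGen, h]
  | Kinv_K a =>
    rw [sub_eq_zero]
    ext i j
    by_cases h : i = j
    · subst h
      by_cases h1 : i = a <;> simp [natGen, h1, zpow_ne_zero _ hq]
    · simp [natGen, h]
  | K_e a i => rw [natGen, natGen_K_single, formRoot, sub_self]
  | K_f a i => rw [natGen, natGen_K_single, formRoot, neg_sub, sub_self]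
  | e_f i j h =>
    have h1 : (i : ℕ) ≠ j := fun h' => h (Fin.ext h')
    simp [natGen, qbr, lo, hi, h1, h1.symm]
  | e_f_same i =>
    have hne := lo_ne_hi i
    have hd := q_sub_inv_ne_zero
    have hD : (q - q⁻¹)⁻¹ * (q - q⁻¹) = 1 := inv_mul_cancel₀ hd
    have hD' : (q⁻¹ - q)⁻¹ = -(q - q⁻¹)⁻¹ := by
      rw [← neg_sub]; exact neg_inv.symm
    have h01 : ∀ x : ZMod 2, x = 0 ∨ x = 1 := by decide
    have h11 : (1 : ZMod 2) + 1 = 0 := by decide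
    ext a b
    by_cases hab : a = b
    · subst hab
      by_cases hl : a = lo i
      · subst hl
        rcases h01 (p (lo i)) with h1 | h1 <;> rcases h01 (p (hi i)) with h2 | h2 <;>
          simp [natGen, qbr, dd, deg, koszul, sgn, h1, h2, hne, hne.symm, h11, hD'] <;>
          first | done | linear_combination hD | linear_combination -hD
      · by_cases hh : a = hi i
        · subst hh
          rcases h01 (p (lo i)) with h1 | h1 <;> rcases h01 (p (hi i)) with h2 | h2 <;>
            simp [natGen, qbr, dd, deg, koszul, sgn, h1, h2, hne, hne.symm, h11, hD'] <;>
            first | done | linear_combination hD | linear_combination -hD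
        · simp [natGen, qbr, hl, hh, Ne.symm hl, Ne.symm hh]
    · have hl : ¬(lo i = a ∧ lo i = b) := by rintro ⟨rfl, rfl⟩; exact hab rfl
      have hh : ¬(hi i = a ∧ hi i = b) := by rintro ⟨rfl, rfl⟩; exact hab rfl
      simp [natGen, qbr, hab, hl, hh]
  | serre_e y h => exact natGen_serre_e p y h
  | serre_f y h => exact natGen_serre_f p y h

/-- The action of `U_q` on the natural module. -/
def natAct : Uq p →ₐ[F] Module.End F (Fin N → F) :=
  Matrix.toLinAlgEquiv'.toAlgHom.comp
    (RingQuot.liftAlgHom F ⟨FreeAlgebra.lift F (natGen p), by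
      rintro x y ⟨hx, rfl⟩
      rw [map_zero]
      refine natGen_rel p _ ?_
      exact defRel_map p (FreeAlgebra.lift F (natGen p)) (fun g => by simp) hx⟩)

theorem natAct_gen (g : Gen N) : natAct p (gen p g) = Matrix.toLinAlgEquiv' (natGen p g) := by
  simp [natAct, gen]

theorem sgn_eq (a : Fin N) : sgn p a = 1 ∨ sgn p a = -1 := by
  unfold sgn; split_ifs <;> simp

theorem sgn_mul_single (a b : Fin N) (x : F) :
    Matrix.diagonal (fun a => (sgn p a : F)) * Matrix.single a b x =
      koszul 1 (p a + p b) •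
        (Matrix.single a b x * Matrix.diagonal (fun a => (sgn p a : F))) := by
  have h01 : ∀ x : ZMod 2, x = 0 ∨ x = 1 := by decide
  have h11 : (1 : ZMod 2) + 1 = 0 := by decide
  ext i j
  simp only [Matrix.mul_diagonal, Matrix.diagonal_mul, Matrix.smul_apply, smul_eq_mul,
    Matrix.single_apply]
  by_cases h : a = i ∧ b = j
  · obtain ⟨rfl, rfl⟩ := h
    rcases h01 (p a) with h1 | h1 <;> rcases h01 (p b) with h2 | h2 <;>
      simp [sgn, koszul, h1, h2, h11]
  · simp [h]

/-- The natural `U_q`-module `V_q`, with homogeneous basis vectors `v_a` of parity `[a]`. -/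
def natural : SuperModule p (Fin N → F) where
  act := natAct p
  par := Matrix.toLinAlgEquiv' (Matrix.diagonal fun a => (sgn p a : F))
  par_sq := by
    rw [← map_mul, ← map_one Matrix.toLinAlgEquiv', Matrix.diagonal_mul_diagonal,
      ← Matrix.diagonal_one]
    congr 2
    funext a
    rcases sgn_eq p a with h | h <;> simp [h]
  par_K a := by
    rw [natAct_gen, ← map_mul, ← map_mul]
    simp [natGen, Matrix.diagonal_mul_diagonal, mul_comm]
  par_e i := by
    rw [natAct_gen, ← map_mul, ← map_mul, ← map_smul]
    exact congrArg _ (sgn_mul_single p _ _ _)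
  par_f i := by
    rw [natAct_gen, ← map_mul, ← map_mul, ← map_smul, deg, add_comm]
    exact congrArg _ (sgn_mul_single p _ _ _)

/-- The parities of the basis of `ℂ^{m|n}` ordered by `σ`: the basis vector in position `a` is the
even vector `j` if `σ a = inl j`, and the odd vector `j` if `σ a = inr j`. -/
def parity {m n : ℕ} (σ : Fin (m + n) ≃ Fin m ⊕ Fin n) (a : Fin (m + n)) : ZMod 2 :=
  Sum.elim (fun _ => 0) (fun _ => 1) (σ a)

/-- The underlying space of the natural module `V_q` of `U_q(gl_{m|n})`. -/
abbrev NatSpace (m n : ℕ) : Type := Fin (m + n) → F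

/-- The natural module `V_q` of `U_q(gl_{m|n})`, for the Borel subalgebra of the ordering `σ`. -/
def natMod {m n : ℕ} (σ : Fin (m + n) ≃ Fin m ⊕ Fin n) :
    SuperModule (parity σ) (NatSpace m n) :=
  natural (parity σ)

end Quantum

section Hecke

/-- The defining relations of the braid group on `r` strings. -/
def braidRels (r : ℕ) : Set (FreeGroup (Fin (r - 1))) :=
  {w | (∃ i j : Fin (r - 1), (i : ℕ) + 1 < j ∧
      w = .of i * .of j * (.of j * .of i)⁻¹) ∨
    (∃ i j : Fin (r - 1), (i : ℕ) + 1 = j ∧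
      w = .of i * .of j * .of i * (.of j * .of i * .of j)⁻¹)}

/-- The braid group `B_r` on `r` strings. -/
abbrev BraidGroup (r : ℕ) : Type := PresentedGroup (braidRels r)

/-- The generator `X_i⁺`, indexed from `i = 0`, with inverse `X_i⁻`. -/
def braidGen {r : ℕ} (i : Fin (r - 1)) : BraidGroup r := PresentedGroup.of i

/-- The relations `X_i⁺ - X_i⁻ - (q - q⁻¹) = 0` in the group algebra of the braid group. -/
def heckeRel (r : ℕ) (x y : MonoidAlgebra F (BraidGroup r)) : Prop :=
  ∃ i : Fin (r - 1), y = 0 ∧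
    x = MonoidAlgebra.of F _ (braidGen i) - MonoidAlgebra.of F _ (braidGen i)⁻¹ -
      algebraMap F _ (q - q⁻¹)

/-- The Hecke algebra `H_r(q)`, the quotient of the group algebra of `B_r` by the two-sided ideal
generated by the elements `X_i⁺ - X_i⁻ - (q - q⁻¹)`. -/
abbrev Hecke (r : ℕ) : Type := RingQuot (heckeRel r)

/-- The quotient map from the group algebra of the braid group to the Hecke algebra. -/
def toHecke (r : ℕ) : MonoidAlgebra F (BraidGroup r) →ₐ[F] Hecke r :=
  RingQuot.mkAlgHom F (heckeRel r)

end Hecke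

section TensorPower

variable {V : Type} [AddCommGroup V] [Module F V] {r : ℕ}

/-- The linear map `V ⊗ V → V^{⊗ r}` which sends `x ⊗ y` to the tensor of the vectors `v`, with
`x` instead of `v j` and `y` instead of `v k`. -/
def insertPair (v : Fin r → V) (j k : Fin r) (h : j ≠ k) : V ⊗[F] V →ₗ[F] ⨂[F] _ : Fin r, V :=
  TensorProduct.lift <| LinearMap.mk₂ F
    (fun x y => PiTensorProduct.tprod F (Function.update (Function.update v j x) k y))
    (fun x x' y => by
      rw [Function.update_comm h, Function.update_comm h, Function.update_comm h,
        MultilinearMap.map_update_add])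
    (fun a x y => by
      rw [Function.update_comm h, Function.update_comm h, MultilinearMap.map_update_smul])
    (fun x y y' => by rw [MultilinearMap.map_update_add])
    (fun a x y => by rw [MultilinearMap.map_update_smul])

theorem insertPair_tmul (v : Fin r → V) (j k : Fin r) (h : j ≠ k) (x y : V) :
    insertPair v j k h (x ⊗ₜ y) =
      PiTensorProduct.tprod F (Function.update (Function.update v j x) k y) := rfl

theorem insertPair_update_left (v : Fin r → V) (j k : Fin r) (h : j ≠ k) (z : V) :
    insertPair (Function.update v j z) j k h = insertPair v j k h := by
  ext x y; simp [insertPair_tmul]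

theorem insertPair_update_right (v : Fin r → V) (j k : Fin r) (h : j ≠ k) (z : V) :
    insertPair (Function.update v k z) j k h = insertPair v j k h := by
  ext x y
  simp [insertPair_tmul, Function.update_comm h]

theorem insertPair_update_add (v : Fin r → V) (j k t : Fin r) (h : j ≠ k) (hj : t ≠ j)
    (hk : t ≠ k) (z z' : V) :
    insertPair (Function.update v t (z + z')) j k h =
      insertPair (Function.update v t z) j k h + insertPair (Function.update v t z') j k h := by
  ext x y
  simp [insertPair_tmul, Function.update_comm hj, Function.update_comm hk]

theorem insertPair_update_smul (v : Fin r → V) (j k t : Fin r) (h : j ≠ k) (hj : t ≠ j)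
    (hk : t ≠ k) (a : F) (z : V) :
    insertPair (Function.update v t (a • z)) j k h =
      a • insertPair (Function.update v t z) j k h := by
  ext x y
  simp [insertPair_tmul, Function.update_comm hj, Function.update_comm hk]

/-- The operator on `V^{⊗ r}` which applies `c` to the tensor factors `j` and `k`. -/
def applyPair (c : Module.End F (V ⊗[F] V)) (j k : Fin r) (h : j ≠ k) :
    Module.End F (⨂[F] _ : Fin r, V) :=
  PiTensorProduct.lift
    { toFun := fun v => insertPair v j k h (c (v j ⊗ₜ v k))
      map_update_add' := by
        intro inst v t x y
        rw [Subsingleton.elim inst (instDecidableEqFin r)]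
        by_cases hj : t = j
        · subst hj
          simp [insertPair_update_left, h.symm, TensorProduct.add_tmul]
        · by_cases hk : t = k
          · subst hk
            simp [insertPair_update_right, h, TensorProduct.tmul_add]
          · simp [insertPair_update_add _ _ _ _ h hj hk, Ne.symm hj, Ne.symm hk]
      map_update_smul' := by
        intro inst v t a x
        rw [Subsingleton.elim inst (instDecidableEqFin r)]
        by_cases hj : t = j
        · subst hj
          simp [insertPair_update_left, h.symm, ← TensorProduct.smul_tmul']
        · by_cases hk : t = k
          · subst hk
            simp [insertPair_update_right, h]
          · simp [insertPair_update_smul _ _ _ _ h hj hk, Ne.symm hj, Ne.symm hk] }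

/-- The operator `id^{⊗ (r-i-1)} ⊗ c ⊗ id^{⊗ (i-1)}` on `V^{⊗ r}`, for `1 ≤ i ≤ r - 1`; here the
index is shifted by one. -/
def braidOp (c : Module.End F (V ⊗[F] V)) (i : Fin (r - 1)) : Module.End F (⨂[F] _ : Fin r, V) :=
  applyPair c ⟨r - 2 - i, by omega⟩ ⟨r - 2 - i + 1, by omega⟩ (by simp)

end TensorPower

end QGL

end

/-! ### Arithmetic in `ℂ(q)`: `q` is not a root of unity. -/

namespace QGL

/-! Everything is reduced to one explicit operator `braiding`. It fixes `v_a ⊗ v_a` up to the scalar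
`q` (`a` even) or `-q⁻¹` (`a` odd), and for `a ≠ b` sends `v_a ⊗ v_b` to `± v_b ⊗ v_a`, plus `(q -
q⁻¹) v_a ⊗ v_b` when `b < a`. A finite check on basis vectors shows that it commutes with the
coproduct action (`braiding_comulAct`).

Existence of `R`: `τ ∘ braiding` factors as `K Θ`, with `Θ - 1` a combination of the operators
`E_{ba} ⊗ E_{ab}`, `b < a`, each of which comes from a product of words in the `e_i` and the `f_i`
(`isRMatrix_flip_comp_braiding`). Uniqueness: by weights, any term of `U⁺_β ⊗ U⁻_{-β}` with `β > 0`
sends `v_a ⊗ v_b` to a multiple of `v_b ⊗ v_a`, and to zero unless `b < a` (`wordAct_tens`). So `τR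
- braiding` is diagonal with entries `t a b` supported on `b < a`. Commuting with the `f_i`
propagates the zeros on the diagonal `a = b` to all pairs (`flip_comp_eq_braiding`).

The operator satisfies `c² = (q - q⁻¹)c + 1`. Its eigenprojections for `q` and `-q⁻¹` are `P[s]` and
`P[a]`, and their ranks are traces. Each image is simple: a nonzero submodule contains, by
separation of weights, some nonzero image of a `v_a ⊗ v_b` (`exists_eigenProj_tens_mem`), and from
it the `e_i` and `f_i` reach the images of all other basis vectors (`eigenProj_tens_mem_of_mem`).

On `V^{⊗ r}` the braid relation comes down to three identities between coefficients
(`applyPair_braiding_braid`). The quadratic relation provides the inverses and the descent to the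
Hecke algebra. -/

theorem q_zpow_injective : Function.Injective fun k : ℤ => q ^ k := by
  have key : ∀ k : ℕ, q ^ k = 1 → k = 0 := by
    intro k h
    have h2 : (Polynomial.X ^ k : Polynomial ℂ) = 1 := by
      apply RatFunc.algebraMap_injective ℂ
      simpa [q] using h
    simpa using congrArg Polynomial.natDegree h2
  intro k l h
  have h1 : q ^ (k - l) = 1 := by
    rw [zpow_sub₀ q_ne_zero, div_eq_one_iff_eq (zpow_ne_zero _ q_ne_zero)]; exact h
  rcases Int.eq_nat_or_neg (k - l) with ⟨d, hd | hd⟩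
  · rw [hd, zpow_natCast] at h1
    have := key d h1
    omega
  · rw [hd, zpow_neg, inv_eq_one, zpow_natCast] at h1
    have := key d h1
    omega

/-- Otherwise `q² = -1`, so `q⁴ = 1`. This is the denominator of the eigenprojections and, up to
sign, the coefficient that appears when `e_i` or `f_i` acts on a `v_a ⊗ v_a`. -/
theorem q_add_inv_ne_zero : q + q⁻¹ ≠ 0 := by
  intro h
  have hq := q_ne_zero
  have h1 : q ^ 2 = -1 := by
    field_simp at h
    linear_combination h
  have h2 : q ^ (4 : ℤ) = q ^ (0 : ℤ) := by
    have : q ^ (4 : ℤ) = (q ^ 2) ^ 2 := by rw [← pow_mul]; rfl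
    rw [this, h1]; simp
  exact absurd (q_zpow_injective h2) (by norm_num)

noncomputable instance : Algebra ℕ F := Semiring.toNatAlgebra

noncomputable instance : Algebra ℤ F := Ring.toIntAlgebra F

/-- Characteristic zero allows a dimension to be recovered from a trace, which is an element of `F`.
-/
instance : CharZero F := charZero_of_injective_algebraMap (algebraMap ℂ F).injective

theorem zmod_two_eq (x : ZMod 2) : x = 0 ∨ x = 1 := by
  revert x; decide

/-! ### Coordinates on `V ⊗ V`. -/

section Basis

variable {N : ℕ}

/-- The basis vector `v_a ⊗ v_b` of `V ⊗ V`. -/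
noncomputable def tens (a b : Fin N) : (Fin N → F) ⊗[F] (Fin N → F) :=
  Pi.single a 1 ⊗ₜ[F] Pi.single b 1

/-- The basis of `V ⊗ V` which consists of the vectors `v_a ⊗ v_b`. -/
noncomputable def tensBasis (N : ℕ) :
    Module.Basis (Fin N × Fin N) F ((Fin N → F) ⊗[F] (Fin N → F)) :=
  (Pi.basisFun F (Fin N)).tensorProduct (Pi.basisFun F (Fin N))

theorem tensBasis_apply (x : Fin N × Fin N) : tensBasis N x = tens x.1 x.2 := by
  simp [tensBasis, tens, Module.Basis.tensorProduct_apply']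

theorem tens_ext {M : Type*} [AddCommGroup M] [Module F M]
    {f g : (Fin N → F) ⊗[F] (Fin N → F) →ₗ[F] M} (h : ∀ a b, f (tens a b) = g (tens a b)) :
    f = g :=
  (tensBasis N).ext fun x => by rw [tensBasis_apply]; exact h _ _

/-- The operator on `V ⊗ V` with `v_a ⊗ v_b ↦ x a b • v_a ⊗ v_b + y a b • v_b ⊗ v_a`. -/
noncomputable def diagSwap (x y : Fin N → Fin N → F) : Module.End F ((Fin N → F) ⊗[F] (Fin N → F)) :=
  (tensBasis N).constr F fun t => x t.1 t.2 • tens t.1 t.2 + y t.1 t.2 • tens t.2 t.1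

theorem diagSwap_tens (x y : Fin N → Fin N → F) (a b : Fin N) :
    diagSwap x y (tens a b) = x a b • tens a b + y a b • tens b a := by
  have := (tensBasis N).constr_basis F
    (fun t : Fin N × Fin N => x t.1 t.2 • tens t.1 t.2 + y t.1 t.2 • tens t.2 t.1) (a, b)
  rwa [tensBasis_apply] at this

theorem tensBasis_repr_tens (a b c d : Fin N) :
    (tensBasis N).repr (tens a b) (c, d) = if a = c ∧ b = d then 1 else 0 := by
  have : tens a b = tensBasis N (a, b) := (tensBasis_apply (a, b)).symm
  rw [this, Module.Basis.repr_self, Finsupp.single_apply]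
  simp

end Basis

/-! ### The generators on `v_a` and on `v_a ⊗ v_b`. -/

section Action

variable {N : ℕ} (p : Fin N → ZMod 2)

/-- The eigenvalue of `k_i` on `v_a`. -/
noncomputable def kEig (i : Fin (N - 1)) (a : Fin N) : F :=
  (if a = lo i then q ^ sgn p a else 1) * (if a = hi i then q ^ (-sgn p a) else 1)

/-- The coefficient of `v_i` in `f_i v_{i+1}`. -/
noncomputable def fCoeff (i : Fin (N - 1)) : F := if deg p i = 0 then 1 else (sgn p (lo i) : F)

theorem fCoeff_ne_zero (i : Fin (N - 1)) : fCoeff p i ≠ 0 := by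
  unfold fCoeff
  rcases sgn_eq p (lo i) with h | h <;> split_ifs <;> simp [h]

theorem kEig_ne_zero (i : Fin (N - 1)) (a : Fin N) : kEig p i a ≠ 0 := by
  have hq := q_ne_zero
  unfold kEig
  split_ifs <;> simp [zpow_ne_zero _ hq]

theorem koszul_ne_zero (a b : ZMod 2) : koszul a b ≠ 0 := by
  unfold koszul; split_ifs <;> simp

theorem natural_act_e (i : Fin (N - 1)) (a : Fin N) :
    (natural p).act (gen p (.e i)) (Pi.single a 1) =
      if a = hi i then Pi.single (lo i) (1 : F) else 0 := by
  change natAct p _ _ = _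
  rw [natAct_gen]
  ext c
  by_cases h : hi i = a
  · subst h; by_cases h' : lo i = c
    · subst h'; simp [natGen]
    · simp [natGen, Matrix.single_apply, h', Ne.symm h']
  · simp [natGen, Matrix.single_apply, h, Ne.symm h]

theorem natural_act_f (i : Fin (N - 1)) (a : Fin N) :
    (natural p).act (gen p (.f i)) (Pi.single a 1) =
      if a = lo i then Pi.single (hi i) (fCoeff p i) else 0 := by
  change natAct p _ _ = _
  rw [natAct_gen]
  ext c
  by_cases h : lo i = a
  · subst h; by_cases h' : hi i = c
    · subst h'; simp [natGen, fCoeff]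
    · simp [natGen, Matrix.single_apply, h', Ne.symm h', fCoeff]
  · simp [natGen, Matrix.single_apply, h, Ne.symm h]

theorem natural_act_K (c a : Fin N) :
    (natural p).act (gen p (.K c)) (Pi.single a 1) =
      (if a = c then q ^ sgn p c else 1) • Pi.single a (1 : F) := by
  change natAct p _ _ = _
  rw [natAct_gen]
  ext b
  by_cases h : b = a
  · subst h; simp [natGen]
  · simp [natGen, h, Matrix.diagonal_apply]

theorem natural_act_Kinv (c a : Fin N) :
    (natural p).act (gen p (.Kinv c)) (Pi.single a 1) =
      (if a = c then q ^ (-sgn p c) else 1) • Pi.single a (1 : F) := by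
  change natAct p _ _ = _
  rw [natAct_gen]
  ext b
  by_cases h : b = a
  · subst h; simp [natGen]
  · simp [natGen, h, Matrix.diagonal_apply]

theorem natural_par (a : Fin N) :
    (natural p).par (Pi.single a 1) = (sgn p a : F) • Pi.single a (1 : F) := by
  change Matrix.toLinAlgEquiv' _ _ = _
  ext b
  by_cases h : b = a
  · subst h; simp
  · simp [h, Matrix.diagonal_apply]

theorem natural_par_pow (x : ZMod 2) (a : Fin N) :
    ((natural p).par ^ x.val) (Pi.single a 1) = koszul x (p a) • Pi.single a (1 : F) := by
  rcases zmod_two_eq x with rfl | rfl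
  · simp [koszul]
  · rw [show (1 : ZMod 2).val = 1 from rfl, pow_one, natural_par]
    rcases zmod_two_eq (p a) with h | h <;> simp [sgn, koszul, h]

theorem natural_k (i : Fin (N - 1)) (a : Fin N) :
    (natural p).k i (Pi.single a 1) = kEig p i a • Pi.single a (1 : F) := by
  rw [SuperModule.k, map_mul, Module.End.mul_apply, natural_act_Kinv, map_smul, natural_act_K,
    smul_smul, kEig, mul_comm]
  congr 2
  · split_ifs with h <;> simp [h]
  · split_ifs with h <;> simp [h]

theorem natural_kinv (i : Fin (N - 1)) (a : Fin N) :
    (natural p).kinv i (Pi.single a 1) = (kEig p i a)⁻¹ • Pi.single a (1 : F) := by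
  rw [SuperModule.kinv, map_mul, Module.End.mul_apply, natural_act_K, map_smul, natural_act_Kinv,
    smul_smul, kEig, mul_comm, mul_inv]
  congr 2
  · split_ifs with h <;> simp [h]
  · split_ifs with h <;> simp [h]

theorem comulAct_e_tens (i : Fin (N - 1)) (a b : Fin N) :
    (natural p).comulAct (natural p) (.e i) (tens a b) =
      (if a = hi i then kEig p i b • tens (lo i) b else 0) +
      (if b = hi i then koszul (deg p i) (p a) • tens a (lo i) else 0) := by
  simp only [SuperModule.comulAct, tens, LinearMap.add_apply, TensorProduct.map_tmul,
    natural_act_e, natural_k, natural_par_pow]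
  congr 1
  · split_ifs <;> simp
  · split_ifs <;> simp [TensorProduct.smul_tmul']

theorem comulAct_f_tens (i : Fin (N - 1)) (a b : Fin N) :
    (natural p).comulAct (natural p) (.f i) (tens a b) = fCoeff p i •
      ((if a = lo i then tens (hi i) b else 0) +
      (if b = lo i then (koszul (deg p i) (p a) * (kEig p i a)⁻¹) • tens a (hi i) else 0)) := by
  have h1 : Pi.single (hi i) (fCoeff p i) = fCoeff p i • (Pi.single (hi i) 1 : Fin N → F) := by
    rw [← Pi.single_smul', smul_eq_mul, mul_one]
  simp only [SuperModule.comulAct, tens, LinearMap.add_apply, TensorProduct.map_tmul,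
    natural_act_f, natural_kinv, natural_par_pow, h1, Module.End.mul_apply, map_smul,
    LinearMap.id_apply, smul_add]
  congr 1
  · split_ifs <;> simp [TensorProduct.smul_tmul']
  · split_ifs <;> simp [TensorProduct.smul_tmul', smul_smul, mul_comm, mul_left_comm]

theorem comulAct_K_tens (c a b : Fin N) :
    (natural p).comulAct (natural p) (.K c) (tens a b) =
      ((if a = c then q ^ sgn p c else 1) * (if b = c then q ^ sgn p c else 1)) • tens a b := by
  simp only [SuperModule.comulAct, tens, TensorProduct.map_tmul, natural_act_K,
    TensorProduct.smul_tmul', TensorProduct.tmul_smul, smul_smul]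
  rw [mul_comm]

theorem comulAct_Kinv_tens (c a b : Fin N) :
    (natural p).comulAct (natural p) (.Kinv c) (tens a b) =
      ((if a = c then q ^ (-sgn p c) else 1) * (if b = c then q ^ (-sgn p c) else 1)) •
        tens a b := by
  simp only [SuperModule.comulAct, tens, TensorProduct.map_tmul, natural_act_Kinv,
    TensorProduct.smul_tmul', TensorProduct.tmul_smul, smul_smul]
  rw [mul_comm]

theorem flip_tens (a b : Fin N) :
    (natural p).flip (natural p) (tens a b) = koszul (p a) (p b) • tens b a := by
  simp only [SuperModule.flip, tens, LinearMap.comp_apply, LinearMap.smul_apply,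
    LinearMap.add_apply, LinearMap.sub_apply, TensorProduct.map_tmul, natural_par,
    LinearMap.id_apply, ← TensorProduct.smul_tmul', TensorProduct.tmul_smul, map_smul, map_add,
    map_sub, LinearEquiv.coe_coe, TensorProduct.comm_tmul]
  generalize (Pi.single b 1 : Fin N → F) ⊗ₜ[F] (Pi.single a 1 : Fin N → F) = z
  rw [show (2 : F)⁻¹ • (z + (sgn p a : F) • z + (sgn p b : F) • z - (sgn p b : F) • (sgn p a : F) • z)
    = ((2 : F)⁻¹ * (1 + (sgn p a : F) + (sgn p b : F) - (sgn p b : F) * (sgn p a : F))) • z by module]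
  congr 1
  rcases zmod_two_eq (p a) with h | h <;> rcases zmod_two_eq (p b) with h' | h' <;>
    simp [sgn, koszul, h, h'] <;> norm_num

end Action

end QGL

namespace QGL

/-! ### The explicit braiding commutes with `U_q`. -/

section Braiding

variable {N : ℕ} (p : Fin N → ZMod 2)

/-- The coefficient of `v_a ⊗ v_b` in the image of `v_a ⊗ v_b` under the braiding. -/
noncomputable def diagCoeff (a b : Fin N) : F :=
  if a = b then sgn p a * q ^ sgn p a else if b < a then q - q⁻¹ else 0

/-- The coefficient of `v_b ⊗ v_a` in the image of `v_a ⊗ v_b` under the braiding, for `a ≠ b`. -/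
noncomputable def swapCoeff (a b : Fin N) : F := if a = b then 0 else koszul (p a) (p b)

/-- The braiding `τ R` of the natural module, in coordinates. -/
noncomputable def braiding : Module.End F ((Fin N → F) ⊗[F] (Fin N → F)) :=
  diagSwap (diagCoeff p) (swapCoeff p)

theorem braiding_tens (a b : Fin N) :
    braiding p (tens a b) = diagCoeff p a b • tens a b + swapCoeff p a b • tens b a :=
  diagSwap_tens _ _ a b

theorem diagCoeff_self (a : Fin N) : diagCoeff p a a = sgn p a * q ^ sgn p a := by
  simp [diagCoeff]

theorem diagCoeff_of_lt {a b : Fin N} (h : a < b) : diagCoeff p a b = 0 := by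
  simp [diagCoeff, h.ne, h.le]

theorem diagCoeff_of_gt {a b : Fin N} (h : b < a) : diagCoeff p a b = q - q⁻¹ := by
  simp [diagCoeff, h.ne', h]

theorem swapCoeff_self (a : Fin N) : swapCoeff p a a = 0 := by
  simp [swapCoeff]

theorem swapCoeff_of_ne {a b : Fin N} (h : a ≠ b) : swapCoeff p a b = koszul (p a) (p b) := by
  simp [swapCoeff, h]

theorem swapCoeff_comm (a b : Fin N) : swapCoeff p a b = swapCoeff p b a := by
  simp [swapCoeff, koszul, and_comm, eq_comm]

theorem swapCoeff_mul_self {a b : Fin N} (h : a ≠ b) : swapCoeff p a b * swapCoeff p a b = 1 := by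
  rw [swapCoeff_of_ne p h]; unfold koszul; split_ifs <;> simp

/-- The coefficient is `q` or `-q⁻¹`, the two roots of `x² = (q - q⁻¹)x + 1`. -/
theorem diagCoeff_self_sq (a : Fin N) :
    diagCoeff p a a * diagCoeff p a a = (q - q⁻¹) * diagCoeff p a a + 1 := by
  have hq := q_ne_zero
  rw [diagCoeff_self]
  rcases sgn_eq p a with h | h <;> simp [h] <;> field_simp <;> ring

theorem lo_lt_hi (i : Fin (N - 1)) : (lo i : Fin N) < hi i := by
  simp [lo, hi, Fin.lt_def]

/-- The two positions of a simple root are adjacent, so every other index compares in the same way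
with both. This is why a third index contributes nothing new to the commutation of the braiding with
`e_i` and `f_i`. -/
theorem lt_hi_iff {i : Fin (N - 1)} {a : Fin N} (h : a ≠ lo i) : a < hi i ↔ a < lo i := by
  have : (a : ℕ) ≠ i := fun h' => h (Fin.ext h')
  simp only [lo, hi, Fin.lt_def]; omega

theorem diagCoeff_lo_left {i : Fin (N - 1)} {b : Fin N} (h : b ≠ lo i) (h' : b ≠ hi i) :
    diagCoeff p (lo i) b = diagCoeff p (hi i) b := by
  simp [diagCoeff, h.symm, h'.symm, lt_hi_iff h]

theorem diagCoeff_lo_right {i : Fin (N - 1)} {b : Fin N} (h : b ≠ lo i) (h' : b ≠ hi i) :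
    diagCoeff p b (lo i) = diagCoeff p b (hi i) := by
  have h1 : lo i < b ↔ hi i < b := by
    rw [← not_le, ← not_le, le_iff_lt_or_eq, le_iff_lt_or_eq, lt_hi_iff h]
    simp [h, h']
  simp [diagCoeff, h, h', h1]

/-- The Koszul sign is bimultiplicative and `deg p i` is the sum of the parities at `lo i` and `hi
i`. -/
theorem swapCoeff_lo {i : Fin (N - 1)} {b : Fin N} (h : b ≠ lo i) (h' : b ≠ hi i) :
    swapCoeff p b (lo i) = koszul (deg p i) (p b) * swapCoeff p b (hi i) := by
  have h11 : (1 : ZMod 2) + 1 = 0 := by decide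
  rw [swapCoeff_of_ne p h, swapCoeff_of_ne p h', deg]
  rcases zmod_two_eq (p b) with h1 | h1 <;> rcases zmod_two_eq (p (lo i)) with h2 | h2 <;>
    rcases zmod_two_eq (p (hi i)) with h3 | h3 <;> simp [koszul, h1, h2, h3, h11]

theorem swapCoeff_hi {i : Fin (N - 1)} {b : Fin N} (h : b ≠ lo i) (h' : b ≠ hi i) :
    swapCoeff p b (hi i) = koszul (deg p i) (p b) * swapCoeff p b (lo i) := by
  have h11 : (1 : ZMod 2) + 1 = 0 := by decide
  rw [swapCoeff_of_ne p h, swapCoeff_of_ne p h', deg]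
  rcases zmod_two_eq (p b) with h1 | h1 <;> rcases zmod_two_eq (p (lo i)) with h2 | h2 <;>
    rcases zmod_two_eq (p (hi i)) with h3 | h3 <;> simp [koszul, h1, h2, h3, h11]

theorem kEig_other {i : Fin (N - 1)} {b : Fin N} (h : b ≠ lo i) (h' : b ≠ hi i) :
    kEig p i b = 1 := by
  simp [kEig, h, h']

theorem kEig_lo (i : Fin (N - 1)) : kEig p i (lo i) = q ^ sgn p (lo i) := by
  simp [kEig, lo_ne_hi]

theorem kEig_hi (i : Fin (N - 1)) : kEig p i (hi i) = q ^ (-sgn p (hi i)) := by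
  simp [kEig, (lo_ne_hi i).symm]

theorem braiding_comulAct_e (i : Fin (N - 1)) :
    braiding p * (natural p).comulAct (natural p) (.e i) =
      (natural p).comulAct (natural p) (.e i) * braiding p := by
  have hq := q_ne_zero
  have hlh := lo_ne_hi i
  have h11 : (1 : ZMod 2) + 1 = 0 := by decide
  -- Only vectors with both indices in `{lo i, hi i}` need an identity: `key1` serves `v_hi ⊗ v_lo`,
  -- `key2` serves `v_lo ⊗ v_hi`, and `key3`, `key4` are the two coefficients for `v_hi ⊗ v_hi`.
  have key1 : diagCoeff p (lo i) (lo i) * q ^ sgn p (lo i) =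
      q ^ sgn p (lo i) * (q - q⁻¹) + koszul (p (hi i)) (p (lo i)) * koszul (deg p i) (p (lo i)) := by
    rw [diagCoeff_self, deg]
    rcases zmod_two_eq (p (lo i)) with h2 | h2 <;> rcases zmod_two_eq (p (hi i)) with h3 | h3 <;>
      simp [koszul, sgn, h2, h3, h11] <;> field_simp <;> ring
  have key2 : koszul (p (lo i)) (p (hi i)) * q ^ sgn p (lo i) =
      koszul (deg p i) (p (lo i)) * diagCoeff p (lo i) (lo i) := by
    rw [diagCoeff_self, deg]
    rcases zmod_two_eq (p (lo i)) with h2 | h2 <;> rcases zmod_two_eq (p (hi i)) with h3 | h3 <;>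
      simp [koszul, sgn, h2, h3, h11]
  have key3 : koszul (deg p i) (p (hi i)) * koszul (p (hi i)) (p (lo i)) =
      diagCoeff p (hi i) (hi i) * q ^ (-sgn p (hi i)) := by
    rw [diagCoeff_self, deg]
    rcases zmod_two_eq (p (lo i)) with h2 | h2 <;> rcases zmod_two_eq (p (hi i)) with h3 | h3 <;>
      simp [koszul, sgn, h2, h3, h11, hq]
  have key4 : q ^ (-sgn p (hi i)) * koszul (p (lo i)) (p (hi i)) + 
      koszul (deg p i) (p (hi i)) * (q - q⁻¹) =
      diagCoeff p (hi i) (hi i) * koszul (deg p i) (p (hi i)) := by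
    rw [diagCoeff_self, deg]
    rcases zmod_two_eq (p (lo i)) with h2 | h2 <;> rcases zmod_two_eq (p (hi i)) with h3 | h3 <;>
      simp [koszul, sgn, h2, h3, h11] <;> ring
  refine tens_ext fun a b => ?_
  simp only [Module.End.mul_apply, comulAct_e_tens, map_add, braiding_tens, map_smul]
  by_cases ha : a = hi i
  · subst ha
    by_cases hb : b = hi i
    · subst hb
      simp only [if_true, map_smul, braiding_tens, map_zero, swapCoeff_self, kEig_hi,
        swapCoeff_of_ne p hlh, swapCoeff_of_ne p hlh.symm, diagCoeff_of_lt p (lo_lt_hi i),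
        diagCoeff_of_gt p (lo_lt_hi i)]
      linear_combination (norm := module) key4 • tens (hi i) (lo i) + key3 • tens (lo i) (hi i)
    · by_cases hb' : b = lo i
      · subst hb'
        simp only [if_true, if_neg hlh, map_smul, braiding_tens, map_zero, swapCoeff_self, kEig_lo,
          swapCoeff_of_ne p hlh, swapCoeff_of_ne p hlh.symm, diagCoeff_of_lt p (lo_lt_hi i),
          diagCoeff_of_gt p (lo_lt_hi i)]
        linear_combination (norm := module) key1 • tens (lo i) (lo i)
      · simp only [if_true, if_neg hb, map_smul, braiding_tens, map_zero, kEig_other p hb' hb,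
          diagCoeff_lo_left p hb' hb, swapCoeff_comm p (lo i) b, swapCoeff_comm p (hi i) b,
          swapCoeff_lo p hb' hb]
        module
  · by_cases hb : b = hi i
    · subst hb
      by_cases ha' : a = lo i
      · subst ha'
        simp only [if_true, if_neg hlh, map_smul, braiding_tens, map_zero, swapCoeff_self, kEig_lo,
          swapCoeff_of_ne p hlh, swapCoeff_of_ne p hlh.symm, diagCoeff_of_lt p (lo_lt_hi i),
          diagCoeff_of_gt p (lo_lt_hi i)]
        linear_combination (norm := module) - key2 • tens (lo i) (lo i)
      · simp only [if_true, if_neg ha, map_smul, braiding_tens, map_zero, kEig_other p ha' ha,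
          diagCoeff_lo_right p ha' ha, swapCoeff_hi p ha' ha]
        module
    · simp [ha, hb]

theorem braiding_comulAct_f (i : Fin (N - 1)) :
    braiding p * (natural p).comulAct (natural p) (.f i) =
      (natural p).comulAct (natural p) (.f i) * braiding p := by
  have hq := q_ne_zero
  have hlh := lo_ne_hi i
  have h11 : (1 : ZMod 2) + 1 = 0 := by decide
  -- Here `key1`, `key2` are the two coefficients for `v_lo ⊗ v_lo`, while `key3` serves `v_lo ⊗
  -- v_hi` and `key4` serves `v_hi ⊗ v_lo`.
  have key1 : (q - q⁻¹) + koszul (deg p i) (p (lo i)) * (q ^ sgn p (lo i))⁻¹ *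
      koszul (p (lo i)) (p (hi i)) = diagCoeff p (lo i) (lo i) := by
    rw [diagCoeff_self, deg]
    rcases zmod_two_eq (p (lo i)) with h2 | h2 <;> rcases zmod_two_eq (p (hi i)) with h3 | h3 <;>
      simp [koszul, sgn, h2, h3, h11] <;> ring
  have key2 : koszul (p (hi i)) (p (lo i)) =
      diagCoeff p (lo i) (lo i) * (koszul (deg p i) (p (lo i)) * (q ^ sgn p (lo i))⁻¹) := by
    rw [diagCoeff_self, deg]
    rcases zmod_two_eq (p (lo i)) with h2 | h2 <;> rcases zmod_two_eq (p (hi i)) with h3 | h3 <;>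
      simp [koszul, sgn, h2, h3, h11, hq]
  have key3 : diagCoeff p (hi i) (hi i) = koszul (p (lo i)) (p (hi i)) *
      (koszul (deg p i) (p (hi i)) * (q ^ (-sgn p (hi i)))⁻¹) := by
    rw [diagCoeff_self, deg]
    rcases zmod_two_eq (p (lo i)) with h2 | h2 <;> rcases zmod_two_eq (p (hi i)) with h3 | h3 <;>
      simp [koszul, sgn, h2, h3, h11]
  have key4 : koszul (deg p i) (p (hi i)) * (q ^ (-sgn p (hi i)))⁻¹ * diagCoeff p (hi i) (hi i) =
      (q - q⁻¹) * (koszul (deg p i) (p (hi i)) * (q ^ (-sgn p (hi i)))⁻¹) +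
        koszul (p (hi i)) (p (lo i)) := by
    rw [diagCoeff_self, deg]
    rcases zmod_two_eq (p (lo i)) with h2 | h2 <;> rcases zmod_two_eq (p (hi i)) with h3 | h3 <;>
      simp [koszul, sgn, h2, h3, h11] <;> field_simp <;> ring
  refine tens_ext fun a b => ?_
  simp only [Module.End.mul_apply, comulAct_f_tens, map_add, braiding_tens, map_smul]
  by_cases ha : a = lo i
  · subst ha
    by_cases hb : b = lo i
    · subst hb
      simp only [if_true, map_smul, braiding_tens, map_zero, swapCoeff_self, kEig_lo,
        swapCoeff_of_ne p hlh, swapCoeff_of_ne p hlh.symm, diagCoeff_of_lt p (lo_lt_hi i),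
        diagCoeff_of_gt p (lo_lt_hi i)]
      linear_combination (norm := module) (fCoeff p i * key1) • tens (hi i) (lo i) +
        (fCoeff p i * key2) • tens (lo i) (hi i)
    · by_cases hb' : b = hi i
      · subst hb'
        simp only [if_true, if_neg hlh.symm, map_smul, braiding_tens, map_zero, swapCoeff_self,
          kEig_hi, swapCoeff_of_ne p hlh, swapCoeff_of_ne p hlh.symm,
          diagCoeff_of_lt p (lo_lt_hi i), diagCoeff_of_gt p (lo_lt_hi i)]
        linear_combination (norm := module) (fCoeff p i * key3) • tens (hi i) (hi i)
      · simp only [if_true, if_neg hb, map_smul, braiding_tens, map_zero, kEig_other p hb hb',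
          diagCoeff_lo_left p hb hb', swapCoeff_comm p (lo i) b, swapCoeff_comm p (hi i) b,
          swapCoeff_hi p hb hb', inv_one]
        module
  · by_cases hb : b = lo i
    · subst hb
      by_cases ha' : a = hi i
      · subst ha'
        simp only [if_true, if_neg hlh.symm, map_smul, braiding_tens, map_zero, swapCoeff_self,
          kEig_hi, swapCoeff_of_ne p hlh, swapCoeff_of_ne p hlh.symm,
          diagCoeff_of_lt p (lo_lt_hi i), diagCoeff_of_gt p (lo_lt_hi i)]
        linear_combination (norm := module) (fCoeff p i * key4) • tens (hi i) (hi i)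
      · simp only [if_true, if_neg ha, map_smul, braiding_tens, map_zero, kEig_other p ha ha',
          diagCoeff_lo_right p ha ha', swapCoeff_lo p ha ha', inv_one]
        module
    · simp [ha, hb]

theorem braiding_comulAct (g : Gen N) :
    braiding p * (natural p).comulAct (natural p) g =
      (natural p).comulAct (natural p) g * braiding p := by
  cases g with
  | e i => exact braiding_comulAct_e p i
  | f i => exact braiding_comulAct_f p i
  | K c =>
    refine tens_ext fun a b => ?_
    simp only [Module.End.mul_apply, comulAct_K_tens, map_add, braiding_tens, map_smul]
    module
  | Kinv c =>
    refine tens_ext fun a b => ?_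
    simp only [Module.End.mul_apply, comulAct_Kinv_tens, map_add, braiding_tens, map_smul]
    module

end Braiding
end QGL

namespace QGL

/-! ### Coefficient identities behind the quadratic relation and the braid relation. -/

section BraidRelation

variable {N : ℕ} (p : Fin N → ZMod 2)

/-- Together with `swapCoeff_mul_diagCoeff`, this is `c² = (q - q⁻¹)c + 1` read off on `v_a ⊗ v_b`:
the coefficients of `v_a ⊗ v_b` and of `v_b ⊗ v_a`. -/
theorem diagCoeff_mul_add (a b : Fin N) :
    diagCoeff p a b * diagCoeff p a b + swapCoeff p a b * swapCoeff p b a =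
      (q - q⁻¹) * diagCoeff p a b + 1 := by
  rcases lt_trichotomy a b with h | rfl | h
  · rw [swapCoeff_comm p b a, swapCoeff_mul_self p h.ne, diagCoeff_of_lt p h]; ring
  · rw [swapCoeff_self, diagCoeff_self_sq]; ring
  · rw [swapCoeff_comm p b a, swapCoeff_mul_self p h.ne', diagCoeff_of_gt p h]

theorem swapCoeff_mul_diagCoeff (a b : Fin N) :
    swapCoeff p a b * (diagCoeff p a b + diagCoeff p b a) = (q - q⁻¹) * swapCoeff p a b := by
  rcases lt_trichotomy a b with h | rfl | h
  · rw [diagCoeff_of_lt p h, diagCoeff_of_gt p h]; ring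
  · rw [swapCoeff_self]; ring
  · rw [diagCoeff_of_lt p h, diagCoeff_of_gt p h]; ring

/-- The coefficient of `v_b ⊗ v_a ⊗ v_d` in the braid relation on `v_a ⊗ v_b ⊗ v_d`. Off the
diagonal the coefficients are `0` or `q - q⁻¹` by order, so the identity expresses transitivity of
the order on `a`, `b`, `d`. -/
theorem swapCoeff_mul_diagCoeff_left (a b d : Fin N) :
    swapCoeff p a b * (diagCoeff p a b * diagCoeff p b d + diagCoeff p a d * diagCoeff p b a) =
      swapCoeff p a b * (diagCoeff p a d * diagCoeff p b d) := by
  rcases lt_trichotomy a b with h | rfl | h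
  · rw [diagCoeff_of_lt p h, diagCoeff_of_gt p h]
    rcases lt_trichotomy a d with h' | rfl | h'
    · rw [diagCoeff_of_lt p h']; ring
    · rw [diagCoeff_of_gt p h]; ring
    · rw [diagCoeff_of_gt p (h'.trans h)]; ring
  · rw [swapCoeff_self]; ring
  · rw [diagCoeff_of_lt p h, diagCoeff_of_gt p h]
    rcases lt_trichotomy b d with h' | rfl | h'
    · rw [diagCoeff_of_lt p h']; ring
    · rw [diagCoeff_of_gt p h]; ring
    · rw [diagCoeff_of_gt p (h'.trans h)]; ring

theorem swapCoeff_mul_diagCoeff_right (a b d : Fin N) :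
    swapCoeff p b d * (diagCoeff p b d * diagCoeff p a b + diagCoeff p a d * diagCoeff p d b) =
      swapCoeff p b d * (diagCoeff p a d * diagCoeff p a b) := by
  rcases lt_trichotomy b d with h | rfl | h
  · rw [diagCoeff_of_lt p h, diagCoeff_of_gt p h]
    rcases lt_trichotomy a d with h' | rfl | h'
    · rw [diagCoeff_of_lt p h']; ring
    · rw [diagCoeff_of_gt p h]; ring
    · rw [diagCoeff_of_gt p (h.trans h')]; ring
  · rw [swapCoeff_self]; ring
  · rw [diagCoeff_of_lt p h, diagCoeff_of_gt p h]
    rcases lt_trichotomy a b with h' | rfl | h'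
    · rw [diagCoeff_of_lt p h']; ring
    · rw [diagCoeff_of_gt p h]; ring
    · rw [diagCoeff_of_gt p (h.trans h')]; ring

/-- The coefficient of `v_a ⊗ v_b ⊗ v_d` itself in the braid relation. -/
theorem diagCoeff_cubic (a b d : Fin N) :
    diagCoeff p a b * diagCoeff p a b * diagCoeff p b d +
        swapCoeff p a b * swapCoeff p b a * diagCoeff p a d =
      diagCoeff p b d * diagCoeff p b d * diagCoeff p a b +
        swapCoeff p b d * swapCoeff p d b * diagCoeff p a d := by
  have h1 := diagCoeff_mul_add p a b
  have h2 := diagCoeff_mul_add p b d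
  -- The quadratic relation removes the squares of diagonal coefficients. What is left involves only
  -- products of opposite swap coefficients, which are `1` for distinct indices and `0` for equal
  -- ones.
  suffices h : (swapCoeff p a b * swapCoeff p b a - swapCoeff p b d * swapCoeff p d b) *
      diagCoeff p a d = ((swapCoeff p a b * swapCoeff p b a - 1) * diagCoeff p b d -
        (swapCoeff p b d * swapCoeff p d b - 1) * diagCoeff p a b) by
    linear_combination h + diagCoeff p b d * h1 - diagCoeff p a b * h2
  rw [swapCoeff_comm p b a, swapCoeff_comm p d b]
  by_cases hab : a = b
  · subst hab
    by_cases hbd : a = d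
    · subst hbd; ring
    · rw [swapCoeff_self, swapCoeff_mul_self p hbd]; ring
  · by_cases hbd : b = d
    · subst hbd
      rw [swapCoeff_self, swapCoeff_mul_self p hab]; ring
    · rw [swapCoeff_mul_self p hab, swapCoeff_mul_self p hbd]; ring

end BraidRelation

/-! ### Braid group and Hecke algebra on `V^{⊗ r}`. -/

section TensorPower

variable {N r : ℕ}

/-- The basis vectors `v_{u(1)} ⊗ ⋯ ⊗ v_{u(r)}` of the tensor power. -/
noncomputable def tensPow (u : Fin r → Fin N) : ⨂[F] _ : Fin r, (Fin N → F) :=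
  PiTensorProduct.tprod F fun t => Pi.single (u t) 1

theorem tensPow_ext {M : Type} [AddCommMonoid M] [Module F M]
    {f g : (⨂[F] _ : Fin r, (Fin N → F)) →ₗ[F] M}
    (h : ∀ u : Fin r → Fin N, f (tensPow u) = g (tensPow u)) : f = g := by
  refine PiTensorProduct.ext ?_
  refine Module.Basis.ext_multilinear (fun _ => Pi.basisFun F (Fin N)) fun u => ?_
  simpa [tensPow] using h u

theorem applyPair_tprod {V : Type} [AddCommGroup V] [Module F V] (c : Module.End F (V ⊗[F] V))
    (j k : Fin r) (h : j ≠ k) (v : Fin r → V) :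
    applyPair c j k h (PiTensorProduct.tprod F v) = insertPair v j k h (c (v j ⊗ₜ v k)) := by
  simp [applyPair]

/-- On basis tensors a swap of factors is a permutation of the index function, so relations between
such operators become relations between transpositions together with identities of scalars. -/
theorem applyPair_diagSwap (x y : Fin N → Fin N → F) (j k : Fin r) (h : j ≠ k)
    (u : Fin r → Fin N) :
    applyPair (diagSwap x y) j k h (tensPow u) =
      x (u j) (u k) • tensPow u + y (u j) (u k) • tensPow (u ∘ Equiv.swap j k) := by
  have := diagSwap_tens x y (u j) (u k)
  simp only [tens] at this
  rw [tensPow, applyPair_tprod, this, map_add, map_smul, map_smul, insertPair_tmul,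
    insertPair_tmul]
  congr 3
  · simp
  · ext1 t
    by_cases ht : t = k
    · subst ht; simp
    · by_cases ht' : t = j
      · subst ht'; simp [h]
      · simp [ht, ht', Equiv.swap_apply_of_ne_of_ne]

theorem applyPair_commute (x y x' y' : Fin N → Fin N → F) {j k l m : Fin r} (h : j ≠ k)
    (h' : l ≠ m) (hjl : j ≠ l) (hjm : j ≠ m) (hkl : k ≠ l) (hkm : k ≠ m) :
    applyPair (diagSwap x y) j k h * applyPair (diagSwap x' y') l m h' =
      applyPair (diagSwap x' y') l m h' * applyPair (diagSwap x y) j k h := by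
  refine tensPow_ext fun u => ?_
  have hs : (u ∘ Equiv.swap l m) ∘ Equiv.swap j k = (u ∘ Equiv.swap j k) ∘ Equiv.swap l m := by
    have : Equiv.swap l m * Equiv.swap j k = Equiv.swap j k * Equiv.swap l m :=
      (Equiv.Perm.Disjoint.commute (by
        rw [Equiv.Perm.disjoint_iff_eq_or_eq]
        intro t
        by_cases ht : t = j ∨ t = k
        · left
          rcases ht with rfl | rfl <;> apply Equiv.swap_apply_of_ne_of_ne <;> assumption
        · push Not at ht
          exact Or.inr (Equiv.swap_apply_of_ne_of_ne ht.1 ht.2)))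
    ext t
    exact congrArg (fun e : Equiv.Perm (Fin r) => (u (e t) : ℕ)) this
  simp only [Module.End.mul_apply, applyPair_diagSwap, map_add, map_smul, hs, Function.comp_apply,
    Equiv.swap_apply_of_ne_of_ne hjl hjm, Equiv.swap_apply_of_ne_of_ne hkl hkm,
    Equiv.swap_apply_of_ne_of_ne hjl.symm hkl.symm, Equiv.swap_apply_of_ne_of_ne hjm.symm hkm.symm]
  module

variable (p : Fin N → ZMod 2)

theorem applyPair_braiding_braid {j k l : Fin r} (hjk : j ≠ k) (hkl : k ≠ l) (hjl : j ≠ l) :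
    applyPair (braiding p) j k hjk * applyPair (braiding p) k l hkl *
        applyPair (braiding p) j k hjk =
      applyPair (braiding p) k l hkl * applyPair (braiding p) j k hjk *
        applyPair (braiding p) k l hkl := by
  refine tensPow_ext fun u => ?_
  have hs (u : Fin r → Fin N) : (u ∘ Equiv.swap j k) ∘ Equiv.swap j k = u := by
    ext t; simp
  have hs' (u : Fin r → Fin N) : (u ∘ Equiv.swap k l) ∘ Equiv.swap k l = u := by
    ext t; simp
  have hb : ((u ∘ Equiv.swap j k) ∘ Equiv.swap k l) ∘ Equiv.swap j k =
      ((u ∘ Equiv.swap k l) ∘ Equiv.swap j k) ∘ Equiv.swap k l := by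
    have : Equiv.swap j k * Equiv.swap k l * Equiv.swap j k =
        Equiv.swap k l * Equiv.swap j k * Equiv.swap k l := by
      rw [Equiv.swap_mul_swap_mul_swap hjk hjl, Equiv.swap_comm j k, Equiv.swap_comm k l,
        Equiv.swap_mul_swap_mul_swap hkl.symm hjl.symm, Equiv.swap_comm]
    ext t
    exact congrArg (fun e : Equiv.Perm (Fin r) => (u (e t) : ℕ)) this
  have h1 := diagCoeff_cubic p (u j) (u k) (u l)
  have h2 := swapCoeff_mul_diagCoeff_left p (u j) (u k) (u l)
  have h3 := swapCoeff_mul_diagCoeff_right p (u j) (u k) (u l)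
  simp only [braiding, Module.End.mul_apply, applyPair_diagSwap, map_add, map_smul, hs, hs', hb,
    Function.comp_apply, Equiv.swap_apply_left, Equiv.swap_apply_right,
    Equiv.swap_apply_of_ne_of_ne hjk hjl, Equiv.swap_apply_of_ne_of_ne hjl.symm hkl.symm]
  -- Both sides expand over the six permutations of three places. The terms from two or three swaps
  -- agree already, which leaves the identity permutation and the two transpositions.
  linear_combination (norm := module) h1 • tensPow u +
    h2 • tensPow (u ∘ Equiv.swap j k) - h3 • tensPow (u ∘ Equiv.swap k l)

theorem applyPair_braiding_mul_self {j k : Fin r} (h : j ≠ k) :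
    applyPair (braiding p) j k h * applyPair (braiding p) j k h =
      (q - q⁻¹) • applyPair (braiding p) j k h + 1 := by
  refine tensPow_ext fun u => ?_
  have hs (u : Fin r → Fin N) : (u ∘ Equiv.swap j k) ∘ Equiv.swap j k = u := by
    ext t; simp
  have h1 := diagCoeff_mul_add p (u j) (u k)
  have h2 := swapCoeff_mul_diagCoeff p (u j) (u k)
  simp only [braiding, Module.End.mul_apply, LinearMap.add_apply, LinearMap.smul_apply,
    Module.End.one_apply, applyPair_diagSwap, map_add, map_smul, hs,
    Function.comp_apply, Equiv.swap_apply_left, Equiv.swap_apply_right]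
  linear_combination (norm := module) h1 • tensPow u + h2 • tensPow (u ∘ Equiv.swap j k)

theorem braidOp_mul_self (r : ℕ) (i : Fin (r - 1)) :
    braidOp (r := r) (braiding p) i * braidOp (braiding p) i =
      (q - q⁻¹) • braidOp (braiding p) i + 1 :=
  applyPair_braiding_mul_self p _

/-- The operator of a braid generator, as a unit. -/
noncomputable def braidUnit (r : ℕ) (i : Fin (r - 1)) :
    (Module.End F (⨂[F] _ : Fin r, (Fin N → F)))ˣ where
  val := braidOp (braiding p) i
  -- From `c² = (q - q⁻¹)c + 1`, that is `c (c - (q - q⁻¹)) = 1`.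
  inv := braidOp (braiding p) i + (q⁻¹ - q) • 1
  val_inv := by
    rw [mul_add, braidOp_mul_self, mul_smul_comm, mul_one]
    module
  inv_val := by
    rw [add_mul, braidOp_mul_self, smul_mul_assoc, one_mul]
    module

theorem braidUnit_rel (r : ℕ) (w : FreeGroup (Fin (r - 1))) (hw : w ∈ braidRels r) :
    FreeGroup.lift (braidUnit p r) w = 1 := by
  rcases hw with ⟨i, j, hij, rfl⟩ | ⟨i, j, hij, rfl⟩
  · rw [map_mul, map_inv, mul_inv_eq_one]
    ext1
    simp only [map_mul, FreeGroup.lift_apply_of, Units.val_mul, braidUnit, braidOp, braiding]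
    apply applyPair_commute <;> simp only [ne_eq, Fin.mk.injEq] <;> omega
  · rw [map_mul, map_inv, mul_inv_eq_one]
    ext1
    simp only [map_mul, FreeGroup.lift_apply_of, Units.val_mul, braidUnit, braidOp]
    -- Generators are numbered from the right: the pair of places for `i` lies one step to the right
    -- of the pair for `j = i + 1`. Hence the braid relation is used with its sides exchanged.
    have h : r - 2 - (i : ℕ) = r - 2 - (j : ℕ) + 1 := by omega
    simp only [h]
    refine (applyPair_braiding_braid p _ _ ?_).symm
    simp only [ne_eq, Fin.mk.injEq]
    omega

/-- The representation of the braid group on the tensor power of the natural module. -/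
noncomputable def braidRep (r : ℕ) : Representation F (BraidGroup r) (⨂[F] _ : Fin r, (Fin N → F)) :=
  (Units.coeHom _).comp (PresentedGroup.toGroup (braidUnit_rel p r))

theorem braidRep_braidGen {r : ℕ} (i : Fin (r - 1)) :
    braidRep p r (braidGen i) = braidOp (braiding p) i := by
  simp [braidRep, braidGen, braidUnit]

theorem braidRep_braidGen_inv {r : ℕ} (i : Fin (r - 1)) :
    braidRep p r (braidGen i)⁻¹ = braidOp (braiding p) i + (q⁻¹ - q) • 1 := by
  simp [braidRep, braidGen, braidUnit, Units.inv_mk]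

theorem exists_hecke_hom (r : ℕ) :
    ∃ νH : Hecke r →ₐ[F] Module.End F (⨂[F] _ : Fin r, (Fin N → F)),
      ∀ x, νH (toHecke r x) = (braidRep p r).asAlgebraHom x := by
  refine ⟨RingQuot.liftAlgHom F ⟨(braidRep p r).asAlgebraHom, ?_⟩, fun x =>
    RingQuot.liftAlgHom_mkAlgHom_apply F _ _ x⟩
  rintro x y ⟨i, rfl, rfl⟩
  have hx : MonoidAlgebra.of F (BraidGroup r) (braidGen i) -
        MonoidAlgebra.of F (BraidGroup r) (braidGen i)⁻¹ -
        algebraMap F (MonoidAlgebra F (BraidGroup r)) (q - q⁻¹) =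
      MonoidAlgebra.of F (BraidGroup r) (braidGen i) +
        (-1 : F) • MonoidAlgebra.of F (BraidGroup r) (braidGen i)⁻¹ +
        (q⁻¹ - q) • (1 : MonoidAlgebra F (BraidGroup r)) := by
    rw [Algebra.algebraMap_eq_smul_one]
    module
  rw [hx, map_add, map_add, map_smul, map_smul, map_one, map_zero, MonoidAlgebra.of_apply,
    MonoidAlgebra.of_apply, Representation.asAlgebraHom_single_one,
    Representation.asAlgebraHom_single_one, braidRep_braidGen, braidRep_braidGen_inv]
  module

end TensorPower

end QGL

namespace QGL

/-! ### The eigenprojections of the braiding. -/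

section Projections

variable {N : ℕ} (p : Fin N → ZMod 2)

theorem braiding_mul_self : braiding p * braiding p = (q - q⁻¹) • braiding p + 1 := by
  refine tens_ext fun a b => ?_
  have h1 := diagCoeff_mul_add p a b
  have h2 := swapCoeff_mul_diagCoeff p a b
  simp only [Module.End.mul_apply, LinearMap.add_apply, LinearMap.smul_apply,
    Module.End.one_apply, braiding_tens, map_add, map_smul]
  linear_combination (norm := module) h1 • tens a b + h2 • tens b a

theorem neg_q_inv_inv : (-q⁻¹)⁻¹ = -q := by
  have hq := q_ne_zero
  apply inv_eq_of_mul_eq_one_right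
  field_simp

/-- `l` is one of the two eigenvalues `q`, `-q⁻¹` of the braiding. -/
def IsHeckeEig (l : F) : Prop := l = q ∨ l = -q⁻¹

theorem IsHeckeEig.ne_zero {l : F} (h : IsHeckeEig l) : l ≠ 0 := by
  have hq := q_ne_zero
  rcases h with rfl | rfl <;> simp [hq]

theorem IsHeckeEig.add_inv_ne_zero {l : F} (h : IsHeckeEig l) : l + l⁻¹ ≠ 0 := by
  have hq := q_add_inv_ne_zero
  rcases h with rfl | rfl
  · exact hq
  · intro h
    apply hq
    rw [neg_q_inv_inv] at h
    linear_combination -h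

/-- So the quadratic relation reads `(c - l)(c + l⁻¹) = 0` for either eigenvalue, and both
projections can be treated at once. -/
theorem IsHeckeEig.sub_inv {l : F} (h : IsHeckeEig l) : l - l⁻¹ = q - q⁻¹ := by
  rcases h with rfl | rfl
  · rfl
  · rw [neg_q_inv_inv]; ring

/-- The projection to the eigenspace of the braiding for the eigenvalue `l`. -/
noncomputable def eigenProj (l : F) : Module.End F ((Fin N → F) ⊗[F] (Fin N → F)) :=
  (l + l⁻¹)⁻¹ • (braiding p + l⁻¹ • 1)

variable {l : F}

theorem braiding_mul_eigenProj (h : IsHeckeEig l) :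
    braiding p * eigenProj p l = l • eigenProj p l := by
  have h1 := h.sub_inv
  have h2 : l * l⁻¹ = 1 := mul_inv_cancel₀ h.ne_zero
  refine LinearMap.ext fun x => ?_
  have h3 := LinearMap.congr_fun (braiding_mul_self p) x
  rw [← h1] at h3
  simp only [eigenProj, Module.End.mul_apply, LinearMap.add_apply, LinearMap.smul_apply, map_add,
    map_smul, Module.End.one_apply] at h3 ⊢
  rw [h3]
  linear_combination (norm := module) -(((l + l⁻¹)⁻¹ * h2) • x)

theorem eigenProj_mul_self (h : IsHeckeEig l) :
    eigenProj p l * eigenProj p l = eigenProj p l := by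
  have h1 := braiding_mul_eigenProj p h
  have h2 : (l + l⁻¹)⁻¹ * (l + l⁻¹) = 1 := inv_mul_cancel₀ h.add_inv_ne_zero
  conv_lhs => enter [1]; rw [eigenProj]
  rw [smul_mul_assoc, add_mul, h1, smul_mul_assoc, one_mul, ← add_smul, smul_smul, h2, one_smul]

theorem eigenProj_comulAct (l : F) (g : Gen N) :
    eigenProj p l * (natural p).comulAct (natural p) g =
      (natural p).comulAct (natural p) g * eigenProj p l := by
  rw [eigenProj, smul_mul_assoc, mul_smul_comm, add_mul, mul_add, braiding_comulAct,
    smul_mul_assoc, mul_smul_comm, one_mul, mul_one]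

theorem comulAct_eigenProj_apply (l : F) (g : Gen N) (x : (Fin N → F) ⊗[F] (Fin N → F)) :
    (natural p).comulAct (natural p) g (eigenProj p l x) =
      eigenProj p l ((natural p).comulAct (natural p) g x) :=
  (LinearMap.congr_fun (eigenProj_comulAct p l g) x).symm

theorem eigenProj_apply_of_mem (h : IsHeckeEig l) {x : (Fin N → F) ⊗[F] (Fin N → F)}
    (hx : x ∈ LinearMap.range (eigenProj p l)) : eigenProj p l x = x := by
  obtain ⟨y, rfl⟩ := hx
  exact LinearMap.congr_fun (eigenProj_mul_self p h) y

/-- For `a < b` the braiding only swaps, up to sign, and the projection turns the braiding into the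
scalar `l`. -/
theorem eigenProj_tens_swap (h : IsHeckeEig l) {a b : Fin N} (hab : a < b) :
    eigenProj p l (tens b a) = (koszul (p a) (p b) * l) • eigenProj p l (tens a b) := by
  have h1 : eigenProj p l * braiding p = l • eigenProj p l := by
    rw [← braiding_mul_eigenProj p h, eigenProj, smul_mul_assoc, mul_smul_comm, add_mul, mul_add,
      smul_mul_assoc, mul_smul_comm, one_mul, mul_one]
  have h2 := LinearMap.congr_fun h1 (tens a b)
  have h3 : koszul (p a) (p b) * koszul (p a) (p b) = 1 := by
    rw [← swapCoeff_of_ne p hab.ne, swapCoeff_mul_self p hab.ne]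
  rw [Module.End.mul_apply, braiding_tens, diagCoeff_of_lt p hab, zero_smul, zero_add, map_smul,
    swapCoeff_of_ne p hab.ne, LinearMap.smul_apply] at h2
  rw [mul_smul, ← h2, smul_smul, h3, one_smul]

theorem eigenProj_tens_mem_span (h : IsHeckeEig l) (a b : Fin N) :
    ∃ t : F, t ≠ 0 ∧ eigenProj p l (tens b a) = t • eigenProj p l (tens a b) := by
  rcases lt_trichotomy a b with hab | rfl | hab
  · exact ⟨_, mul_ne_zero (koszul_ne_zero _ _) h.ne_zero, eigenProj_tens_swap p h hab⟩
  · exact ⟨1, one_ne_zero, (one_smul _ _).symm⟩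
  · refine ⟨_, inv_ne_zero (mul_ne_zero (koszul_ne_zero (p b) (p a)) h.ne_zero), ?_⟩
    rw [eigenProj_tens_swap p h hab, smul_smul, inv_mul_cancel₀
      (mul_ne_zero (koszul_ne_zero _ _) h.ne_zero), one_smul]

theorem eigenProj_tens_self (a : Fin N) :
    eigenProj p l (tens a a) = ((l + l⁻¹)⁻¹ * (diagCoeff p a a + l⁻¹)) • tens a a := by
  simp only [eigenProj, LinearMap.smul_apply, LinearMap.add_apply, braiding_tens, swapCoeff_self,
    Module.End.one_apply]
  module

/-- The vector `v_a ⊗ v_a` is an eigenvector of the braiding, with eigenvalue `l` or `-l⁻¹`. In the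
second case the projection kills it. -/
theorem diagCoeff_self_of_eigenProj_ne_zero (h : IsHeckeEig l) {a : Fin N}
    (ha : eigenProj p l (tens a a) ≠ 0) : diagCoeff p a a = l := by
  have h1 := diagCoeff_self_sq p a
  rw [← h.sub_inv] at h1
  have h2 : l * l⁻¹ = 1 := mul_inv_cancel₀ h.ne_zero
  have h3 : (diagCoeff p a a - l) * (diagCoeff p a a + l⁻¹) = 0 := by
    linear_combination h1 - h2
  rcases mul_eq_zero.mp h3 with h4 | h4
  · exact sub_eq_zero.mp h4
  · exact absurd (by rw [eigenProj_tens_self, h4, mul_zero, zero_smul]) ha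

end Projections

/-! ### Ranks of the projections as traces. -/

section Dimension

variable {N : ℕ} (p : Fin N → ZMod 2)

theorem finrank_range_of_mul_self_eq {K V : Type*} [Field K] [AddCommGroup V] [Module K V]
    [FiniteDimensional K V] {P : Module.End K V} (h : P * P = P) :
    (Module.finrank K (LinearMap.range P) : K) = LinearMap.trace K V P :=
  (LinearMap.IsIdempotentElem.isProj_range P h).trace.symm

theorem trace_diagSwap (x y : Fin N → Fin N → F) (hy : ∀ a, y a a = 0) :
    LinearMap.trace F _ (diagSwap x y) = ∑ a, ∑ b, x a b := by
  rw [LinearMap.trace_eq_matrix_trace F (tensBasis N), Matrix.trace, Fintype.sum_prod_type]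
  refine Finset.sum_congr rfl fun a _ => Finset.sum_congr rfl fun b _ => ?_
  rw [Matrix.diag_apply, LinearMap.toMatrix_apply, tensBasis_apply, diagSwap_tens, map_add,
    map_smul, map_smul, Finsupp.add_apply, Finsupp.smul_apply, Finsupp.smul_apply,
    tensBasis_repr_tens, tensBasis_repr_tens]
  by_cases h : b = a
  · subst h; simp [hy]
  · simp [h]

/-- Each of the `N.choose 2` pairs with `b < a` contributes `q - q⁻¹`. -/
theorem sum_diagCoeff :
    ∑ a, ∑ b, diagCoeff p a b = ∑ a, diagCoeff p a a + (q - q⁻¹) * (N.choose 2 : ℕ) := by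
  have h1 : ∀ a : Fin N, ∑ b, diagCoeff p a b = diagCoeff p a a + (q - q⁻¹) * ((a : ℕ) : F) := by
    intro a
    rw [← Finset.add_sum_erase _ _ (Finset.mem_univ a)]
    congr 1
    have : ∀ b ∈ Finset.univ.erase a, diagCoeff p a b = if b < a then q - q⁻¹ else 0 := by
      intro b hb
      rw [diagCoeff, if_neg (Finset.ne_of_mem_erase hb).symm]
    rw [Finset.sum_congr rfl this, ← Finset.sum_filter, Finset.sum_const, nsmul_eq_mul, mul_comm]
    have : (Finset.univ.erase a).filter (· < a) = Finset.Iio a := by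
      ext b; simp; exact ne_of_lt
    rw [this, Fin.card_Iio]
  rw [Finset.sum_congr rfl fun a _ => h1 a, Finset.sum_add_distrib, ← Finset.mul_sum,
    ← Nat.cast_sum, Fin.sum_univ_eq_sum_range (fun i => i), Finset.sum_range_id, Nat.choose_two_right]

theorem sum_diagCoeff_parity {m n : ℕ} (σ : Fin (m + n) ≃ Fin m ⊕ Fin n) :
    ∑ a, diagCoeff (parity σ) a a = m * q - n * q⁻¹ := by
  have h : ∀ a, diagCoeff (parity σ) a a =
      Sum.elim (fun _ : Fin m => q) (fun _ : Fin n => -q⁻¹) (σ a) := by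
    intro a
    rw [diagCoeff_self]
    rcases h : σ a with j | j <;> simp [sgn, parity, h]
  rw [Finset.sum_congr rfl fun a _ => h a, Equiv.sum_comp σ, Fintype.sum_sum_type]
  simp
  ring

/-- The trace of an idempotent is its rank. Multiplying by `l + l⁻¹` leaves the trace of `c + l⁻¹`.
-/
theorem finrank_range_eigenProj {l : F} (h : IsHeckeEig l) {m n : ℕ}
    (σ : Fin (m + n) ≃ Fin m ⊕ Fin n) :
    (l + l⁻¹) * (Module.finrank F (LinearMap.range (eigenProj (parity σ) l)) : F) =
      m * q - n * q⁻¹ + (q - q⁻¹) * ((m + n).choose 2 : ℕ) + l⁻¹ * (m + n) ^ 2 := by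
  have h1 := finrank_range_of_mul_self_eq (eigenProj_mul_self (parity σ) h)
  have h2 : LinearMap.trace F _ (1 : Module.End F ((Fin (m + n) → F) ⊗[F] (Fin (m + n) → F))) =
      (m + n) ^ 2 := by
    rw [LinearMap.trace_one, Module.finrank_eq_card_basis (tensBasis (m + n))]
    simp; ring
  rw [h1, eigenProj, map_smul, map_add, map_smul, h2, braiding,
    trace_diagSwap _ _ (swapCoeff_self _), sum_diagCoeff, sum_diagCoeff_parity, smul_eq_mul,
    mul_inv_cancel_left₀ h.add_inv_ne_zero, smul_eq_mul]

theorem finrank_range_symm {m n : ℕ} (σ : Fin (m + n) ≃ Fin m ⊕ Fin n) :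
    Module.finrank F (LinearMap.range (eigenProj (parity σ) q)) =
      (m + 1).choose 2 + m * n + n.choose 2 := by
  have h := finrank_range_eigenProj (Or.inl rfl) σ
  apply Nat.cast_injective (R := F)
  apply mul_left_cancel₀ q_add_inv_ne_zero
  rw [h]
  push_cast [Nat.cast_choose_two]
  ring

theorem finrank_range_alt {m n : ℕ} (σ : Fin (m + n) ≃ Fin m ⊕ Fin n) :
    Module.finrank F (LinearMap.range (eigenProj (parity σ) (-q⁻¹))) =
      m.choose 2 + m * n + (n + 1).choose 2 := by
  have h := finrank_range_eigenProj (Or.inr rfl) σ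
  apply Nat.cast_injective (R := F)
  apply mul_left_cancel₀ (IsHeckeEig.add_inv_ne_zero (Or.inr rfl))
  rw [h, neg_q_inv_inv]
  push_cast [Nat.cast_choose_two]
  ring

end Dimension

end QGL

namespace QGL

/-! ### Moving a pair of indices by single steps. -/

section Connectivity

variable {N : ℕ} {S : Fin N → Fin N → Prop}

theorem move_up (up : ∀ a a' b : Fin N, (a : ℕ) + 1 = a' → b ≠ a → S a b → S a' b) {b : Fin N}
    (k : ℕ) (a a' : Fin N) (h : (a : ℕ) + k = a') (hb : ∀ t, a ≤ t → t < a' → b ≠ t)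
    (hS : S a b) : S a' b := by
  induction k generalizing a' with
  | zero => rwa [← show a = a' from Fin.ext h]
  | succ k ih =>
    have h1 : (⟨a + k, by omega⟩ : Fin N) < a' := by rw [Fin.lt_def]; simp only; omega
    refine up ⟨a + k, by omega⟩ a' b h (hb _ ?_ h1)
      (ih ⟨a + k, by omega⟩ rfl fun t ht ht' => hb t ht (ht'.trans h1))
    rw [Fin.le_def]; simp

theorem move_down (down : ∀ a a' b : Fin N, (a : ℕ) + 1 = a' → b ≠ a' → S a' b → S a b)
    {b : Fin N} (k : ℕ) (a a' : Fin N) (h : (a : ℕ) + k = a')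
    (hb : ∀ t, a < t → t ≤ a' → b ≠ t) (hS : S a' b) : S a b := by
  induction k generalizing a with
  | zero => rwa [show a = a' from Fin.ext h]
  | succ k ih =>
    have h1 : a < (⟨a + 1, by omega⟩ : Fin N) := by rw [Fin.lt_def]; simp
    refine down a ⟨a + 1, by omega⟩ b rfl (hb _ h1 ?_)
      (ih ⟨a + 1, by omega⟩ (by simp only; omega) fun t ht ht' => hb t (h1.trans ht) ht')
    rw [Fin.le_def]; simp only; omega

/-- The moves mirror `f_i` and `e_i` acting on a tensor whose other index is not hit. They can enter
a diagonal pair but never leave one, so the start must be off the diagonal. The smaller index is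
brought to `0`, then the other one is moved freely, and last the index `0` is raised to the smaller
target. -/
theorem forall_of_moves (swap : ∀ a b, S a b → S b a)
    (up : ∀ a a' b : Fin N, (a : ℕ) + 1 = a' → b ≠ a → S a b → S a' b)
    (down : ∀ a a' b : Fin N, (a : ℕ) + 1 = a' → b ≠ a' → S a' b → S a b)
    {a b : Fin N} (hab : a ≠ b) (hS : S a b) (c d : Fin N) : S c d := by
  wlog h : a < b generalizing a b
  · exact this hab.symm (swap _ _ hS) (lt_of_le_of_ne (not_lt.mp h) hab.symm)
  wlog hcd : c ≤ d generalizing c d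
  · exact swap _ _ (this d c (le_of_not_ge hcd))
  let o : Fin N := ⟨0, by omega⟩
  have ho : ∀ t, o ≤ t := fun t => Fin.le_def.mpr (Nat.zero_le _)
  have h1 : S o b := move_down down a o a (by simp [o]) (fun t _ ht => (ht.trans_lt h).ne') hS
  have h2 : S o o :=
    move_down down b o b (by simp [o]) (fun t ht _ => ht.ne) (swap _ _ h1)
  have h3 : ∀ t, S t o := by
    intro t
    rcases le_total t b with ht | ht
    · exact move_down down (b - t) t b (by have := Fin.le_def.mp ht; omega)
        (fun s hs _ => ((ho t).trans_lt hs).ne) (swap _ _ h1)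
    · exact move_up up (t - b) b t (by have := Fin.le_def.mp ht; omega)
        (fun s hs _ => (((ho a).trans_lt h).trans_le hs).ne) (swap _ _ h1)
  exact move_up up c o c (by simp [o]) (fun t _ ht => (ht.trans_le hcd).ne') (swap _ _ (h3 d))

end Connectivity

/-! ### The images of the projections are simple. -/

section Simple

variable {N : ℕ} (p : Fin N → ZMod 2) {l : F}

theorem exists_lo_hi {a b : Fin N} (h : (a : ℕ) + 1 = b) :
    ∃ i : Fin (N - 1), a = lo i ∧ b = hi i :=
  ⟨⟨a, by omega⟩, rfl, Fin.ext h.symm⟩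

theorem comulAct_f_eigenProj {i : Fin (N - 1)} {b : Fin N} (h : b ≠ lo i) :
    (natural p).comulAct (natural p) (.f i) (eigenProj p l (tens (lo i) b)) =
      fCoeff p i • eigenProj p l (tens (hi i) b) := by
  rw [comulAct_eigenProj_apply, comulAct_f_tens, if_pos rfl, if_neg h, add_zero, map_smul]

theorem comulAct_e_eigenProj {i : Fin (N - 1)} {b : Fin N} (h : b ≠ hi i) :
    (natural p).comulAct (natural p) (.e i) (eigenProj p l (tens (hi i) b)) =
      kEig p i b • eigenProj p l (tens (lo i) b) := by
  rw [comulAct_eigenProj_apply, comulAct_e_tens, if_pos rfl, if_neg h, add_zero, map_smul]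

/-- This leaves the diagonal, where `forall_of_moves` cannot start. Both terms of `Δ(f_i)`
contribute. Since the projection is nonzero, `l` is the braiding eigenvalue of `v_lo ⊗ v_lo`, and
the terms add up to `±(q + q⁻¹)` instead of cancelling. -/
theorem comulAct_f_eigenProj_self (h : IsHeckeEig l) {i : Fin (N - 1)}
    (hi0 : eigenProj p l (tens (lo i) (lo i)) ≠ 0) :
    ∃ t : F, t ≠ 0 ∧
      (natural p).comulAct (natural p) (.f i) (eigenProj p l (tens (lo i) (lo i))) =
        t • eigenProj p l (tens (lo i) (hi i)) := by
  have hl := diagCoeff_self_of_eigenProj_ne_zero p h hi0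
  refine ⟨fCoeff p i * (koszul (p (lo i)) (p (hi i)) * l +
    koszul (deg p i) (p (lo i)) * (kEig p i (lo i))⁻¹), mul_ne_zero (fCoeff_ne_zero p i) ?_, ?_⟩
  · have h11 : (1 : ZMod 2) + 1 = 0 := by decide
    have hq := q_add_inv_ne_zero
    have hq' : -q⁻¹ - q ≠ 0 := fun h => hq (by linear_combination -h)
    rw [← hl, diagCoeff_self, kEig_lo, deg]
    rcases zmod_two_eq (p (lo i)) with h2 | h2 <;> rcases zmod_two_eq (p (hi i)) with h3 | h3 <;>
      simp [koszul, sgn, h2, h3, h11, hq]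
    · intro h; exact hq (by linear_combination -h)
    · intro h; exact hq (by linear_combination h)
  · rw [comulAct_eigenProj_apply, comulAct_f_tens, if_pos rfl, if_pos rfl, map_smul, map_add,
      map_smul, eigenProj_tens_swap p h (lo_lt_hi i)]
    module

theorem comulAct_e_eigenProj_self (h : IsHeckeEig l) {i : Fin (N - 1)}
    (hi0 : eigenProj p l (tens (hi i) (hi i)) ≠ 0) :
    ∃ t : F, t ≠ 0 ∧
      (natural p).comulAct (natural p) (.e i) (eigenProj p l (tens (hi i) (hi i))) =
        t • eigenProj p l (tens (lo i) (hi i)) := by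
  have hl := diagCoeff_self_of_eigenProj_ne_zero p h hi0
  refine ⟨kEig p i (hi i) + koszul (deg p i) (p (hi i)) * (koszul (p (lo i)) (p (hi i)) * l),
    ?_, ?_⟩
  · have h11 : (1 : ZMod 2) + 1 = 0 := by decide
    have hq := q_add_inv_ne_zero
    rw [← hl, diagCoeff_self, kEig_hi, deg]
    rcases zmod_two_eq (p (lo i)) with h2 | h2 <;> rcases zmod_two_eq (p (hi i)) with h3 | h3 <;>
      simp [koszul, sgn, h2, h3, h11, hq]
    all_goals intro h; exact hq (by linear_combination h)
  · rw [comulAct_eigenProj_apply, comulAct_e_tens, if_pos rfl, if_pos rfl, map_add,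
      map_smul, map_smul, eigenProj_tens_swap p h (lo_lt_hi i)]
    module

theorem mem_of_smul_mem' {V : Type*} [AddCommGroup V] [Module F V] {L : Submodule F V} {t : F}
    (ht : t ≠ 0) {x : V} (h : t • x ∈ L) : x ∈ L :=
  (L.smul_mem_iff ht).mp h

theorem eigenProj_tens_mem_of_mem (h : IsHeckeEig l)
    {L : Submodule F ((Fin N → F) ⊗[F] (Fin N → F))}
    (hL : (natural p).IsStable (natural p) L) {a b : Fin N} (hab : eigenProj p l (tens a b) ≠ 0)
    (hmem : eigenProj p l (tens a b) ∈ L) (c d : Fin N) : eigenProj p l (tens c d) ∈ L := by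
  have swap : ∀ a b : Fin N, eigenProj p l (tens a b) ∈ L → eigenProj p l (tens b a) ∈ L := by
    intro a b h1
    obtain ⟨t, -, ht⟩ := eigenProj_tens_mem_span p h a b
    rw [ht]
    exact L.smul_mem t h1
  have up : ∀ a a' b : Fin N, (a : ℕ) + 1 = a' → b ≠ a → eigenProj p l (tens a b) ∈ L →
      eigenProj p l (tens a' b) ∈ L := by
    intro a a' b h1 h2 h3
    obtain ⟨i, rfl, rfl⟩ := exists_lo_hi h1
    have h4 := hL (.f i) _ h3
    rw [comulAct_f_eigenProj p h2] at h4
    exact mem_of_smul_mem' (fCoeff_ne_zero p i) h4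
  have down : ∀ a a' b : Fin N, (a : ℕ) + 1 = a' → b ≠ a' → eigenProj p l (tens a' b) ∈ L →
      eigenProj p l (tens a b) ∈ L := by
    intro a a' b h1 h2 h3
    obtain ⟨i, rfl, rfl⟩ := exists_lo_hi h1
    have h4 := hL (.e i) _ h3
    rw [comulAct_e_eigenProj p h2] at h4
    exact mem_of_smul_mem' (kEig_ne_zero p i b) h4
  by_cases hne : a = b
  · subst hne
    -- From a diagonal pair one steps down the weights with `f_i`, or up with `e_i` if `a` is the
    -- last index. If neither is possible, `N = 1` and there is only one basis vector.
    by_cases ha : (a : ℕ) + 1 < N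
    · obtain ⟨i, hai, -⟩ := exists_lo_hi (a := a) (b := ⟨a + 1, ha⟩) rfl
      rw [hai] at hab hmem
      obtain ⟨t, ht, he⟩ := comulAct_f_eigenProj_self p h hab
      have h4 := hL (.f i) _ hmem
      rw [he] at h4
      exact forall_of_moves (S := fun a b => eigenProj p l (tens a b) ∈ L) swap up down
        (lo_ne_hi i) (mem_of_smul_mem' ht h4) c d
    · by_cases ha' : (a : ℕ) = 0
      · have hc : c = a := Fin.ext (by omega)
        have hd : d = a := Fin.ext (by omega)
        rwa [hc, hd]
      · obtain ⟨i, -, hai⟩ := exists_lo_hi (a := ⟨a - 1, by omega⟩) (b := a)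
          (by simp only; omega)
        rw [hai] at hab hmem
        obtain ⟨t, ht, he⟩ := comulAct_e_eigenProj_self p h hab
        have h4 := hL (.e i) _ hmem
        rw [he] at h4
        exact forall_of_moves (S := fun a b => eigenProj p l (tens a b) ∈ L) swap up down
          (lo_ne_hi i) (mem_of_smul_mem' ht h4) c d
  · exact forall_of_moves (S := fun a b => eigenProj p l (tens a b) ∈ L) swap up down
      hne hmem c d

/-- The eigenvalue of `K_c` on `v_c`. -/
noncomputable def qSgn (c : Fin N) : F := q ^ sgn p c

theorem qSgn_sq_ne_one (c : Fin N) : qSgn p c * qSgn p c ≠ 1 := by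
  intro h
  rw [qSgn, ← zpow_add₀ q_ne_zero] at h
  have h1 := q_zpow_injective (h.trans (zpow_zero q).symm)
  rcases sgn_eq p c with h2 | h2 <;> omega

theorem qSgn_ne_one (c : Fin N) : qSgn p c ≠ 1 := fun h =>
  qSgn_sq_ne_one p c (by rw [h, mul_one])

theorem qSgn_ne_zero (c : Fin N) : qSgn p c ≠ 0 := zpow_ne_zero _ q_ne_zero

/-- `(K_c - 1) (K_c - x)` on `V ⊗ V`. -/
noncomputable def weightFactor (c : Fin N) (x : F) : Module.End F ((Fin N → F) ⊗[F] (Fin N → F)) :=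
  ((natural p).comulAct (natural p) (.K c) - (1 : F) • 1) *
    ((natural p).comulAct (natural p) (.K c) - x • 1)

/-- The eigenvalue of `(K_c - 1) (K_c - x)` on `v_a ⊗ v_b`. -/
noncomputable def weightEig (c : Fin N) (x : F) (a b : Fin N) : F :=
  ((if a = c then qSgn p c else 1) * (if b = c then qSgn p c else 1) - 1) *
    ((if a = c then qSgn p c else 1) * (if b = c then qSgn p c else 1) - x)

theorem weightFactor_tens (c : Fin N) (x : F) (a b : Fin N) :
    weightFactor p c x (tens a b) = weightEig p c x a b • tens a b := by
  simp only [weightEig, weightFactor, Module.End.mul_apply, LinearMap.sub_apply, LinearMap.smul_apply,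
    Module.End.one_apply, comulAct_K_tens, map_sub, map_smul, qSgn]
  module

theorem weightFactor_mem {L : Submodule F ((Fin N → F) ⊗[F] (Fin N → F))}
    (hL : (natural p).IsStable (natural p) L) (c : Fin N) (x : F) {v : (Fin N → F) ⊗[F] (Fin N → F)}
    (hv : v ∈ L) : weightFactor p c x v ∈ L := by
  have key : ∀ y : F, ∀ w ∈ L, ((natural p).comulAct (natural p) (.K c) - y • 1) w ∈ L :=
    fun y w hw => L.sub_mem (hL _ _ hw) (L.smul_mem _ hw)
  exact key _ _ (key _ _ hv)

theorem weightFactor_eigenProj (c : Fin N) (x : F) (v : (Fin N → F) ⊗[F] (Fin N → F)) :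
    weightFactor p c x (eigenProj p l v) = eigenProj p l (weightFactor p c x v) := by
  simp only [weightFactor, Module.End.mul_apply, LinearMap.sub_apply, LinearMap.smul_apply,
    Module.End.one_apply, comulAct_eigenProj_apply, map_sub, map_smul]

/-- `Q` is a polynomial in `K_a`, `K_b` isolating the weight `ℰ_a + ℰ_b`. On basis tensors `K_a` has
the eigenvalues `1`, `x`, `x²` with `x = qSgn p a`, by how many indices equal `a`. For `a = b` the
first two are killed; for `a ≠ b` the first and third are killed, for `a` and for `b`. -/
theorem exists_weightOp (a b : Fin N) :
    ∃ (Q : Module.End F ((Fin N → F) ⊗[F] (Fin N → F))) (φ : Fin N → Fin N → F),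
      (∀ L : Submodule F ((Fin N → F) ⊗[F] (Fin N → F)), (natural p).IsStable (natural p) L →
        ∀ v ∈ L, Q v ∈ L) ∧ (∀ l v, Q (eigenProj p l v) = eigenProj p l (Q v)) ∧
      (∀ c d, Q (tens c d) = φ c d • tens c d) ∧ φ a b ≠ 0 ∧
      ∀ c d, φ c d ≠ 0 → (c = a ∧ d = b) ∨ (c = b ∧ d = a) := by
  have h0 := qSgn_ne_zero p
  have h1 := qSgn_ne_one p
  have h2 := qSgn_sq_ne_one p
  by_cases hab : a = b
  · subst hab
    refine ⟨weightFactor p a (qSgn p a), weightEig p a (qSgn p a), fun L hL v hv => weightFactor_mem p hL _ _ hv,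
      fun l v => weightFactor_eigenProj p _ _ _, weightFactor_tens p _ _, ?_, ?_⟩
    · simp only [weightEig, if_true]
      refine mul_ne_zero (sub_ne_zero.mpr (h2 a)) ?_
      rw [← mul_sub_one]
      exact mul_ne_zero (h0 a) (sub_ne_zero.mpr (h1 a))
    · intro c d hcd
      by_cases hc : c = a <;> by_cases hd : d = a <;> simp [weightEig, hc, hd] at hcd ⊢
  · refine ⟨weightFactor p a (qSgn p a * qSgn p a) * weightFactor p b (qSgn p b * qSgn p b),
      fun c d => weightEig p b (qSgn p b * qSgn p b) c d * weightEig p a (qSgn p a * qSgn p a) c d,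
      fun L hL v hv => ?_, fun l v => ?_, fun c d => ?_, ?_, ?_⟩
    · rw [Module.End.mul_apply]
      exact weightFactor_mem p hL _ _ (weightFactor_mem p hL _ _ hv)
    · rw [Module.End.mul_apply, weightFactor_eigenProj, weightFactor_eigenProj,
        Module.End.mul_apply]
    · rw [Module.End.mul_apply, weightFactor_tens, map_smul, weightFactor_tens, smul_smul]
    · have h3 : ∀ c, qSgn p c - qSgn p c * qSgn p c ≠ 0 := by
        intro c
        rw [← mul_one_sub]
        exact mul_ne_zero (h0 c) (sub_ne_zero.mpr (h1 c).symm)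
      simp [weightEig, hab, Ne.symm hab, h3, sub_ne_zero.mpr (h1 _)]
    · intro c d hcd
      have ha := left_ne_zero_of_mul hcd
      have hb := right_ne_zero_of_mul hcd
      by_cases hc : c = a
      · subst hc
        by_cases hd : d = b
        · exact Or.inl ⟨rfl, hd⟩
        · simp [weightEig, hab, hd] at ha hb
      · by_cases hd : d = a
        · subst hd
          by_cases hc' : c = b
          · exact Or.inr ⟨hc', rfl⟩
          · simp [weightEig, hab, hc'] at ha hb
        · simp [weightEig, hc, hd] at ha hb

theorem tens_sum_repr (v : (Fin N → F) ⊗[F] (Fin N → F)) :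
    ∑ c, ∑ d, (tensBasis N).repr v (c, d) • tens c d = v := by
  conv_rhs => rw [← (tensBasis N).sum_repr v, Fintype.sum_prod_type]
  simp only [tensBasis_apply]

/-- In the image of the projection, the weight of `v_a ⊗ v_b` is spanned by the projection of that
single vector, because the swapped tensor projects to a multiple of it. A nonzero element of `L` has
a nonzero weight component, which lies in `L` and is such a multiple. -/
theorem exists_eigenProj_tens_mem (h : IsHeckeEig l)
    {L : Submodule F ((Fin N → F) ⊗[F] (Fin N → F))}
    (hL : (natural p).IsStable (natural p) L) (hr : L ≤ LinearMap.range (eigenProj p l))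
    (hne : L ≠ ⊥) : ∃ a b, eigenProj p l (tens a b) ≠ 0 ∧ eigenProj p l (tens a b) ∈ L := by
  obtain ⟨x, hx, hx0⟩ := L.exists_mem_ne_zero_of_ne_bot hne
  by_contra! hcon
  apply hx0
  have hz : ∀ a b, (tensBasis N).repr x (a, b) = 0 := by
    intro a b
    obtain ⟨Q, φ, hQL, hQP, hQ, hab, hφ⟩ := exists_weightOp p a b
    have hrepr : ∀ v, (tensBasis N).repr (Q v) (a, b) = φ a b * (tensBasis N).repr v (a, b) := by
      intro v
      have : (Finsupp.lapply (a, b) ∘ₗ (tensBasis N).repr.toLinearMap ∘ₗ Q) =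
          φ a b • (Finsupp.lapply (a, b) ∘ₗ (tensBasis N).repr.toLinearMap) := by
        refine tens_ext fun c d => ?_
        simp only [LinearMap.comp_apply, hQ, map_smul, LinearMap.smul_apply, Finsupp.lapply_apply,
          LinearEquiv.coe_coe, tensBasis_repr_tens]
        by_cases hcd : c = a ∧ d = b
        · obtain ⟨rfl, rfl⟩ := hcd; rfl
        · simp [hcd]
      exact LinearMap.congr_fun this v
    have hspan : ∃ t : F, eigenProj p l (Q x) = t • eigenProj p l (tens a b) := by
      suffices h1 : eigenProj p l (Q x) ∈ Submodule.span F {eigenProj p l (tens a b)} by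
        obtain ⟨t, ht⟩ := Submodule.mem_span_singleton.mp h1
        exact ⟨t, ht.symm⟩
      rw [← tens_sum_repr x]
      simp only [map_sum, map_smul, hQ]
      refine Submodule.sum_mem _ fun c _ => Submodule.sum_mem _ fun d _ =>
        Submodule.smul_mem _ _ ?_
      by_cases h0 : φ c d = 0
      · rw [h0, zero_smul]; exact Submodule.zero_mem _
      · refine Submodule.smul_mem _ _ ?_
        rcases hφ c d h0 with ⟨rfl, rfl⟩ | ⟨rfl, rfl⟩
        · exact Submodule.mem_span_singleton_self _
        · obtain ⟨t, -, ht⟩ := eigenProj_tens_mem_span p h d c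
          rw [ht]
          exact Submodule.smul_mem _ _ (Submodule.mem_span_singleton_self _)
    obtain ⟨t, ht⟩ := hspan
    rw [← hQP, eigenProj_apply_of_mem p h (hr hx)] at ht
    have hQx : Q x = 0 := by
      by_contra hQx
      have ht0 : t ≠ 0 := by rintro rfl; exact hQx (by rw [ht, zero_smul])
      have hw0 : eigenProj p l (tens a b) ≠ 0 := by
        intro h0; exact hQx (by rw [ht, h0, smul_zero])
      refine hcon a b hw0 (mem_of_smul_mem' ht0 ?_)
      rw [← ht]
      exact hQL L hL x hx
    have h1 := hrepr x
    rw [hQx, map_zero, Finsupp.zero_apply] at h1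
    exact (mul_eq_zero.mp h1.symm).resolve_left hab
  rw [← tens_sum_repr x]
  simp [hz]

theorem eigenProj_range_simple (h : IsHeckeEig l)
    (L : Submodule F ((Fin N → F) ⊗[F] (Fin N → F)))
    (hL : (natural p).IsStable (natural p) L) (hr : L ≤ LinearMap.range (eigenProj p l)) :
    L = ⊥ ∨ L = LinearMap.range (eigenProj p l) := by
  refine or_iff_not_imp_left.mpr fun hne => le_antisymm hr ?_
  obtain ⟨a, b, hab, hmem⟩ := exists_eigenProj_tens_mem p h hL hr hne
  rintro _ ⟨v, rfl⟩
  rw [← tens_sum_repr v]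
  simp only [map_sum, map_smul]
  exact Submodule.sum_mem _ fun c _ => Submodule.sum_mem _ fun d _ =>
    Submodule.smul_mem _ _ (eigenProj_tens_mem_of_mem p h hL hab hmem c d)

end Simple

end QGL

namespace QGL

/-! ### Existence and uniqueness of the `R`-matrix on `V ⊗ V`. -/

section RMatrix

variable {N : ℕ} (p : Fin N → ZMod 2)

/-- A word acting nontrivially uses each letter from `c` to `a - 1` once. Only the number and the
sum of the letters are recorded: these do not depend on their order and suffice to find the end
points. -/
theorem exists_act_e_word (s : List (Fin (N - 1))) (a : Fin N) :
    ∃ (c : Fin N) (t : F), (natural p).act (s.map fun i => gen p (.e i)).prod (Pi.single a 1) =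
        t • Pi.single c (1 : F) ∧
      (t ≠ 0 → (c : ℤ) + s.length = a ∧
        2 * (s.map fun i : Fin (N - 1) => ((i : ℕ) : ℤ)).sum = (a : ℤ) * (a - 1) - c * (c - 1)) := by
  induction s with
  | nil => exact ⟨a, 1, by simp, by simp⟩
  | cons i s ih =>
    obtain ⟨c, t, h1, h2⟩ := ih
    by_cases hc : c = hi i
    · refine ⟨lo i, t, ?_, fun ht => ?_⟩
      · rw [List.map_cons, List.prod_cons, map_mul, Module.End.mul_apply, h1, map_smul,
          natural_act_e, if_pos hc]
      · obtain ⟨h3, h4⟩ := h2 ht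
        subst hc
        simp only [lo, hi, List.length_cons, List.map_cons, List.sum_cons, Nat.cast_add,
          Nat.cast_one] at h3 h4 ⊢
        constructor
        · linarith
        · linear_combination h4
    · refine ⟨c, 0, ?_, fun ht => absurd rfl ht⟩
      rw [List.map_cons, List.prod_cons, map_mul, Module.End.mul_apply, h1, map_smul,
          natural_act_e, if_neg hc, smul_zero, zero_smul]

theorem single_fCoeff (i : Fin (N - 1)) :
    Pi.single (hi i) (fCoeff p i) = fCoeff p i • (Pi.single (hi i) 1 : Fin N → F) := by
  rw [← Pi.single_smul', smul_eq_mul, mul_one]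

theorem exists_act_f_word (s : List (Fin (N - 1))) (a : Fin N) :
    ∃ (c : Fin N) (t : F), (natural p).act (s.map fun i => gen p (.f i)).prod (Pi.single a 1) =
        t • Pi.single c (1 : F) ∧
      (t ≠ 0 → (a : ℤ) + s.length = c ∧
        2 * (s.map fun i : Fin (N - 1) => ((i : ℕ) : ℤ)).sum = (c : ℤ) * (c - 1) - a * (a - 1)) := by
  induction s with
  | nil => exact ⟨a, 1, by simp, by simp⟩
  | cons i s ih =>
    obtain ⟨c, t, h1, h2⟩ := ih
    by_cases hc : c = lo i
    · refine ⟨hi i, t * fCoeff p i, ?_, fun ht => ?_⟩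
      · rw [List.map_cons, List.prod_cons, map_mul, Module.End.mul_apply, h1, map_smul,
          natural_act_f, if_pos hc, single_fCoeff, smul_smul]
      · obtain ⟨h3, h4⟩ := h2 (left_ne_zero_of_mul ht)
        subst hc
        simp only [lo, hi, List.length_cons, List.map_cons, List.sum_cons, Nat.cast_add,
          Nat.cast_one] at h3 h4 ⊢
        constructor
        · linarith
        · linear_combination h4
    · refine ⟨c, 0, ?_, fun ht => absurd rfl ht⟩
      rw [List.map_cons, List.prod_cons, map_mul, Module.End.mul_apply, h1, map_smul,
          natural_act_f, if_neg hc, smul_zero, zero_smul]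

theorem wordAct_tens {s s' : List (Fin (N - 1))} (hs : s ≠ []) (hp : s.Perm s') (a b : Fin N) :
    ∃ t : F, (natural p).wordAct (natural p) s s' (tens a b) = t • tens b a ∧
      (t ≠ 0 → b < a) := by
  obtain ⟨c, t, h1, h2⟩ := exists_act_e_word p s a
  obtain ⟨d, t', h3, h4⟩ := exists_act_f_word p s' b
  have hw : (natural p).wordAct (natural p) s s' (tens a b) =
      (koszul ((s'.map (deg p)).sum) (p a) * (t * t')) • tens c d := by
    rw [SuperModule.wordAct, tens, TensorProduct.map_tmul, Module.End.mul_apply, natural_par_pow,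
      map_smul, h1, h3, tens]
    simp only [TensorProduct.smul_tmul', TensorProduct.tmul_smul, smul_smul]
    congr 2
    ring
  by_cases ht : t * t' = 0
  · exact ⟨0, by rw [hw, ht, mul_zero, zero_smul, zero_smul], fun h => absurd rfl h⟩
  · obtain ⟨h5, h6⟩ := h2 (left_ne_zero_of_mul ht)
    obtain ⟨h7, h8⟩ := h4 (right_ne_zero_of_mul ht)
    have hlen := hp.length_eq
    have hsum := (hp.map fun i : Fin (N - 1) => ((i : ℕ) : ℤ)).sum_eq
    have hpos : 0 < s.length := List.length_pos_iff.mpr hs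
    rw [← hlen] at h7
    rw [← hsum] at h8
    have hl0 : (s.length : ℤ) ≠ 0 := by exact_mod_cast hpos.ne'
    -- Equal lengths give `a - c = d - b ≠ 0`. Equal letter sums, divided by this common length,
    -- give `a + c = d + b`. Hence `c = b` and `d = a`.
    have key : (c : ℤ) = b := by
      have : (s.length : ℤ) * (c - b) = 0 := by
        have ha : (a : ℤ) = c + s.length := by linarith
        have hd : (d : ℤ) = b + s.length := by linarith
        rw [ha] at h6
        rw [hd] at h8
        have h9 := h6.symm.trans h8
        linarith
      linarith [(mul_eq_zero.mp this).resolve_left hl0]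
    have hcb : c = b := Fin.ext (by exact_mod_cast key)
    have hda : d = a := Fin.ext (by have : (d : ℤ) = a := by linarith
                                    exact_mod_cast this)
    subst hcb hda
    exact ⟨_, hw, fun _ => Fin.lt_def.mpr (by omega)⟩

theorem unipotentFactor_tens {Θ : Module.End F ((Fin N → F) ⊗[F] (Fin N → F))}
    (h : (natural p).IsUnipotentFactor (natural p) Θ) (a b : Fin N) :
    ∃ t : F, Θ (tens a b) = tens a b + t • tens b a ∧ (t ≠ 0 → b < a) := by
  suffices h1 : ∃ t : F, (Θ - 1) (tens a b) = t • tens b a ∧ (t ≠ 0 → b < a) by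
    obtain ⟨t, h2, h3⟩ := h1
    refine ⟨t, ?_, h3⟩
    rw [LinearMap.sub_apply, Module.End.one_apply] at h2
    rw [← h2]; abel
  refine Submodule.span_induction (p := fun T _ => ∃ t : F, T (tens a b) = t • tens b a ∧
    (t ≠ 0 → b < a)) ?_ ?_ ?_ ?_ h
  · rintro _ ⟨s, s', hs, hp, rfl⟩
    exact wordAct_tens p hs hp a b
  · exact ⟨0, by simp, fun h => absurd rfl h⟩
  · rintro T T' - - ⟨t, h1, h2⟩ ⟨t', h3, h4⟩
    refine ⟨t + t', by rw [LinearMap.add_apply, h1, h3, add_smul], fun h => ?_⟩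
    by_contra hba
    exact h (by rw [not_imp_comm.mp h2 hba, not_imp_comm.mp h4 hba, add_zero])
  · rintro x T - ⟨t, h1, h2⟩
    exact ⟨x * t, by rw [LinearMap.smul_apply, h1, smul_smul], fun h => h2 (right_ne_zero_of_mul h)⟩

/-- The eigenvalue of the Cartan factor on `v_a ⊗ v_b`. -/
noncomputable def cartanEig (a b : Fin N) : F := if a = b then q ^ sgn p a else 1

theorem mem_weightSpace_single (a : Fin N) :
    Pi.single a 1 ∈ (natural p).weightSpace (Pi.single a 1) := by
  intro c
  rw [natural_act_K]
  by_cases h : a = c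
  · subst h; simp
  · simp [h, Pi.single_apply, Ne.symm h]

theorem zpow_sum_single (a b : Fin N) :
    q ^ (∑ c, sgn p c * ((Pi.single a 1 : Fin N → ℤ) c * (Pi.single b 1 : Fin N → ℤ) c)) =
      cartanEig p a b := by
  by_cases h : a = b
  · subst h
    simp [cartanEig, Pi.single_apply]
  · simp [cartanEig, h, Ne.symm h, Pi.single_apply]

theorem cartanFactor_tens {κ : Module.End F ((Fin N → F) ⊗[F] (Fin N → F))}
    (h : (natural p).IsCartanFactor (natural p) κ) (a b : Fin N) :
    κ (tens a b) = cartanEig p a b • tens a b := by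
  rw [← zpow_sum_single]
  exact h _ _ _ (mem_weightSpace_single p a) _ (mem_weightSpace_single p b)

theorem koszul_self (a : Fin N) : koszul (p a) (p a) = sgn p a := by
  rcases zmod_two_eq (p a) with h | h <;> simp [koszul, sgn, h]

theorem koszul_comm (a b : ZMod 2) : koszul a b = koszul b a := by
  simp [koszul, and_comm]

theorem koszul_mul_self (a b : ZMod 2) : koszul a b * koszul a b = 1 := by
  unfold koszul; split_ifs <;> simp

/-- The shape `K Θ` alone determines `τR` up to one unknown scalar for each pair `b < a`. -/
theorem flip_comp_tens {R : Module.End F ((Fin N → F) ⊗[F] (Fin N → F))}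
    (h : ∃ κ Θ, (natural p).IsCartanFactor (natural p) κ ∧
      (natural p).IsUnipotentFactor (natural p) Θ ∧ R = κ * Θ) (a b : Fin N) :
    ∃ t : F, ((natural p).flip (natural p) ∘ₗ R) (tens a b) = braiding p (tens a b) + t • tens a b ∧
      (t ≠ 0 → b < a) := by
  obtain ⟨κ, Θ, hκ, hΘ, rfl⟩ := h
  obtain ⟨t, h1, h2⟩ := unipotentFactor_tens p hΘ a b
  rw [LinearMap.comp_apply, Module.End.mul_apply, h1, map_add, map_smul, cartanFactor_tens p hκ,
    cartanFactor_tens p hκ, map_add, map_smul, map_smul, map_smul, flip_tens, flip_tens,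
    braiding_tens]
  rcases lt_trichotomy a b with hab | rfl | hab
  · refine ⟨0, ?_, fun h => absurd rfl h⟩
    rw [not_imp_comm.mp h2 hab.not_gt, diagCoeff_of_lt p hab, swapCoeff_of_ne p hab.ne, cartanEig,
      if_neg hab.ne]
    module
  · refine ⟨0, ?_, fun h => absurd rfl h⟩
    rw [not_imp_comm.mp h2 (lt_irrefl _), diagCoeff_self, swapCoeff_self, koszul_self, cartanEig,
      if_pos rfl]
    module
  · refine ⟨t * koszul (p b) (p a) - (q - q⁻¹), ?_, fun _ => hab⟩
    rw [diagCoeff_of_gt p hab, swapCoeff_of_ne p hab.ne', cartanEig, if_neg hab.ne', cartanEig,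
      if_neg hab.ne]
    module

theorem tens_ne_zero (a b : Fin N) : tens a b ≠ 0 := by
  have := (tensBasis N).ne_zero (a, b)
  rwa [tensBasis_apply] at this

theorem flip_comp_eq_braiding {R : Module.End F ((Fin N → F) ⊗[F] (Fin N → F))}
    (h : (natural p).IsRMatrix (natural p) R) :
    (natural p).flip (natural p) ∘ₗ R = braiding p := by
  obtain ⟨h1, h2⟩ := h
  choose t ht hlt using fun a b => flip_comp_tens p h1 a b
  obtain ⟨c, hc⟩ : ∃ c, c = (natural p).flip (natural p) ∘ₗ R := ⟨_, rfl⟩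
  rw [← hc] at h2 ht ⊢
  have hD : ∀ i a b, (c - braiding p) ((natural p).comulAct (natural p) (.f i) (tens a b)) =
      t a b • (natural p).comulAct (natural p) (.f i) (tens a b) := by
    intro i a b
    have h3 := LinearMap.congr_fun (h2 (.f i)) (tens a b)
    have h4 := LinearMap.congr_fun (braiding_comulAct p (.f i)) (tens a b)
    rw [LinearMap.comp_apply, LinearMap.comp_apply] at h3
    rw [Module.End.mul_apply, Module.End.mul_apply] at h4
    rw [LinearMap.sub_apply, h3, h4, ht, map_add, map_smul, add_sub_cancel_left]
  have hD' : ∀ a b, (c - braiding p) (tens a b) = t a b • tens a b := by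
    intro a b
    rw [LinearMap.sub_apply, ht, add_sub_cancel_left]
  have ht0 : ∀ a b, a ≤ b → t a b = 0 := fun a b hab =>
    not_imp_comm.mp (hlt a b) hab.not_gt
  -- The diagonal operator `c - braiding` commutes with `f_i`, so its entry is the same at every
  -- basis vector occurring in `f_i (v_lo ⊗ v_b)` as at `v_lo ⊗ v_b`. Induction on `a - b` then
  -- starts from the zero entries at `a = b`.
  have hstep : ∀ (i : Fin (N - 1)) b, b ≤ lo i → t (hi i) b = t (lo i) b := by
    intro i b hb
    have h3 := hD i (lo i) b
    rcases eq_or_lt_of_le hb with rfl | hb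
    · rw [ht0 _ _ le_rfl, zero_smul, comulAct_f_tens, if_pos rfl, if_pos rfl, map_smul, map_add,
        map_smul, hD', hD', ht0 _ _ (lo_lt_hi i).le, zero_smul, smul_zero, add_zero, smul_smul] at h3
      have h4 := (smul_eq_zero.mp h3).resolve_right (tens_ne_zero _ _)
      rw [ht0 _ _ le_rfl]
      exact (mul_eq_zero.mp h4).resolve_left (fCoeff_ne_zero p i)
    · rw [comulAct_f_tens, if_pos rfl, if_neg hb.ne, add_zero, map_smul, hD',
        smul_comm] at h3
      have h4 : (t (hi i) b - t (lo i) b) • fCoeff p i • tens (hi i) b = 0 := by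
        linear_combination (norm := module) h3
      exact sub_eq_zero.mp ((smul_eq_zero.mp h4).resolve_right
        (smul_ne_zero (fCoeff_ne_zero p i) (tens_ne_zero _ _)))
  have hall : ∀ (k : ℕ) (a b : Fin N), (b : ℕ) + k = a → t a b = 0 := by
    intro k
    induction k with
    | zero => intro a b hab; exact ht0 _ _ (Fin.le_def.mpr (by omega))
    | succ k ih =>
      intro a b hab
      obtain ⟨i, h3, h4⟩ := exists_lo_hi (a := ⟨b + k, by omega⟩) (b := a) hab
      rw [h4, hstep i b (by rw [← h3, Fin.le_def]; simp), ← h3]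
      exact ih _ _ rfl
  refine tens_ext fun a b => ?_
  have hz : t a b = 0 := by
    rcases le_total a b with hab | hab
    · exact ht0 a b hab
    · exact hall (a - b) a b (by have := Fin.le_def.mp hab; omega)
  rw [ht, hz, zero_smul, add_zero]

theorem flip_comp_flip : (natural p).flip (natural p) ∘ₗ (natural p).flip (natural p) =
    LinearMap.id := by
  refine tens_ext fun a b => ?_
  rw [LinearMap.comp_apply, flip_tens, map_smul, flip_tens, smul_smul, koszul_comm (p b),
    koszul_mul_self, one_smul, LinearMap.id_apply]

/-- No root vectors are needed: `e_b e_{b+1} ⋯ e_{a-1}` already acts as the matrix unit `E_{ba}`,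
and the reversed word in the `f_i` as a nonzero multiple of `E_{ab}`. -/
theorem exists_root_words (k : ℕ) (a b : Fin N) (h : (b : ℕ) + k + 1 = a) :
    ∃ (s s' : List (Fin (N - 1))) (t : F), s ≠ [] ∧ s.Perm s' ∧ t ≠ 0 ∧
      (∀ c, (natural p).act (s.map fun i => gen p (.e i)).prod (Pi.single c 1) =
        if c = a then Pi.single b (1 : F) else 0) ∧
      (∀ c, (natural p).act (s'.map fun i => gen p (.f i)).prod (Pi.single c 1) =
        if c = b then t • Pi.single a (1 : F) else 0) := by
  have hf := single_fCoeff p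
  induction k generalizing a with
  | zero =>
    obtain ⟨i, rfl, rfl⟩ := exists_lo_hi h
    refine ⟨[i], [i], fCoeff p i, by simp, List.Perm.refl _, fCoeff_ne_zero p i, fun c => ?_,
      fun c => ?_⟩
    · simp [natural_act_e]
    · simp [natural_act_f, hf]
  | succ k ih =>
    obtain ⟨i, h1, rfl⟩ := exists_lo_hi (a := ⟨b + k + 1, by omega⟩) (b := a) h
    obtain ⟨s, s', t, hs, hp, ht, he, hf'⟩ := ih (lo i) (by rw [← h1])
    refine ⟨s ++ [i], i :: s', t * fCoeff p i, by simp, ?_, mul_ne_zero ht (fCoeff_ne_zero p i),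
      fun c => ?_, fun c => ?_⟩
    · exact (List.perm_append_singleton i s).trans (hp.cons i)
    · rw [List.map_append, List.prod_append, map_mul, Module.End.mul_apply, List.map_singleton,
        List.prod_singleton, natural_act_e]
      split_ifs
      · rw [he, if_pos rfl]
      · rw [map_zero]
    · rw [List.map_cons, List.prod_cons, map_mul, Module.End.mul_apply, hf']
      split_ifs
      · rw [map_smul, natural_act_f, if_pos rfl, hf, smul_smul]
      · rw [map_zero]

/-- The operator `E_{ba} ⊗ E_{ab}`. -/
noncomputable def rootOp (a b : Fin N) : Module.End F ((Fin N → F) ⊗[F] (Fin N → F)) :=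
  diagSwap (fun _ _ => 0) (fun c d => if c = a ∧ d = b then 1 else 0)

theorem rootOp_tens (a b c d : Fin N) :
    rootOp a b (tens c d) = if c = a ∧ d = b then tens b a else 0 := by
  rw [rootOp, diagSwap_tens, zero_smul, zero_add]
  split_ifs with h
  · rw [one_smul, h.1, h.2]
  · rw [zero_smul]

theorem rootOp_mem_span {a b : Fin N} (h : b < a) :
    rootOp a b ∈ Submodule.span F {T | ∃ s s' : List (Fin (N - 1)), s ≠ [] ∧ s.Perm s' ∧
      T = (natural p).wordAct (natural p) s s'} := by
  obtain ⟨s, s', t, hs, hp, ht, he, hf⟩ := exists_root_words p (a - b - 1) a b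
    (by have := Fin.lt_def.mp h; omega)
  have hk := koszul_ne_zero ((s'.map (deg p)).sum) (p a)
  have : rootOp a b = (koszul ((s'.map (deg p)).sum) (p a) * t)⁻¹ •
      (natural p).wordAct (natural p) s s' := by
    refine tens_ext fun c d => ?_
    rw [rootOp_tens, LinearMap.smul_apply, SuperModule.wordAct, tens, tens,
      TensorProduct.map_tmul, Module.End.mul_apply, natural_par_pow, map_smul, he, hf]
    by_cases hc : c = a
    · subst hc
      by_cases hd : d = b
      · subst hd
        simp only [and_self, if_true, TensorProduct.smul_tmul', TensorProduct.tmul_smul, smul_smul]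
        rw [mul_comm t, inv_mul_cancel₀ (mul_ne_zero hk ht), one_smul]
      · simp [hd]
    · simp [hc]
  rw [this]
  exact Submodule.smul_mem _ _ (Submodule.subset_span ⟨s, s', hs, hp, rfl⟩)

theorem isUnipotentFactor_diagSwap {y : Fin N → Fin N → F} (hy : ∀ a b, y a b ≠ 0 → b < a) :
    (natural p).IsUnipotentFactor (natural p) (diagSwap (fun _ _ => 1) y) := by
  have h : diagSwap (fun _ _ => 1) y - 1 = ∑ a, ∑ b, y a b • rootOp a b := by
    refine tens_ext fun c d => ?_
    rw [LinearMap.sub_apply, diagSwap_tens, one_smul, Module.End.one_apply, add_sub_cancel_left]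
    simp only [LinearMap.sum_apply, LinearMap.smul_apply, rootOp_tens]
    rw [Finset.sum_eq_single c, Finset.sum_eq_single d]
    · simp
    · intro b _ hb; simp [hb.symm]
    · simp
    · intro a _ ha; simp [ha.symm]
    · simp
  rw [SuperModule.IsUnipotentFactor, h]
  refine Submodule.sum_mem _ fun a _ => Submodule.sum_mem _ fun b _ => ?_
  by_cases hab : y a b = 0
  · rw [hab, zero_smul]; exact Submodule.zero_mem _
  · exact Submodule.smul_mem _ _ (rootOp_mem_span p (hy a b hab))

/-- The Cartan condition ranges over all weight vectors and all integral weights. As `q` is not a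
root of unity, a nonzero coordinate determines the weight. -/
theorem eq_single_of_mem_weightSpace {l : Fin N → ℤ} {w : Fin N → F}
    (hw : w ∈ (natural p).weightSpace l) {a : Fin N} (ha : w a ≠ 0) : l = Pi.single a 1 := by
  funext c
  have h1 := congrFun (hw c) a
  change (natAct p (gen p (.K c)) w) a = _ at h1
  rw [natAct_gen] at h1
  simp only [natGen, Matrix.toLinAlgEquiv'_apply, Matrix.mulVec_diagonal, Pi.smul_apply,
    smul_eq_mul] at h1
  have h2 := mul_right_cancel₀ ha h1
  by_cases hac : a = c
  · subst hac
    rw [if_pos rfl] at h2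
    have h3 := q_zpow_injective h2
    rw [Pi.single_eq_same]
    rcases sgn_eq p a with h | h <;> rw [h] at h3 <;> linarith
  · rw [if_neg hac] at h2
    have h3 := q_zpow_injective ((zpow_zero q).trans h2)
    rw [Pi.single_eq_of_ne (Ne.symm hac)]
    rcases sgn_eq p c with h | h <;> rw [h] at h3 <;> linarith

theorem isCartanFactor_diagSwap :
    (natural p).IsCartanFactor (natural p) (diagSwap (cartanEig p) fun _ _ => 0) := by
  intro l l' w hw w' hw'
  have hsum : w ⊗ₜ[F] w' = ∑ a, ∑ b, (w a * w' b) • tens a b := by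
    conv_lhs => rw [← Finset.univ_sum_single w, ← Finset.univ_sum_single w']
    rw [TensorProduct.sum_tmul]
    refine Finset.sum_congr rfl fun a _ => ?_
    rw [TensorProduct.tmul_sum]
    refine Finset.sum_congr rfl fun b _ => ?_
    have h : ∀ (c : Fin N) (x : F), Pi.single c x = x • (Pi.single c 1 : Fin N → F) := by
      intro c x; rw [← Pi.single_smul', smul_eq_mul, mul_one]
    rw [h a, h b, tens, TensorProduct.tmul_smul, ← TensorProduct.smul_tmul', smul_smul, mul_comm]
  rw [hsum]
  simp only [map_sum, map_smul, Finset.smul_sum]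
  refine Finset.sum_congr rfl fun a _ => Finset.sum_congr rfl fun b _ => ?_
  rw [diagSwap_tens, zero_smul, add_zero]
  by_cases ha : w a = 0
  · rw [ha, zero_mul, zero_smul, zero_smul, smul_zero]
  · by_cases hb : w' b = 0
    · rw [hb, mul_zero, zero_smul, zero_smul, smul_zero]
    · rw [eq_single_of_mem_weightSpace p hw ha, eq_single_of_mem_weightSpace p hw' hb,
        zpow_sum_single, smul_comm]

theorem isRMatrix_flip_comp_braiding :
    (natural p).IsRMatrix (natural p) ((natural p).flip (natural p) ∘ₗ braiding p) := by
  -- The witness is `Θ = 1 + (q - q⁻¹) ∑_{b<a} ± E_{ba} ⊗ E_{ab}`, where the Koszul sign compensates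
  -- the one in the graded flip.
  refine ⟨⟨_, diagSwap (fun _ _ => 1)
    (fun a b => if b < a then koszul (p a) (p b) * (q - q⁻¹) else 0), isCartanFactor_diagSwap p,
    isUnipotentFactor_diagSwap p fun a b h => ?_, ?_⟩, fun g => ?_⟩
  · by_contra hab
    exact h (if_neg hab)
  · refine tens_ext fun a b => ?_
    rw [LinearMap.comp_apply, Module.End.mul_apply, braiding_tens, diagSwap_tens, map_add, map_add,
      map_smul, map_smul, map_smul, map_smul, flip_tens, flip_tens, diagSwap_tens, diagSwap_tens]
    have hk := koszul_mul_self (p a) (p b)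
    rcases lt_trichotomy a b with hab | rfl | hab
    · rw [if_neg hab.not_gt, diagCoeff_of_lt p hab, swapCoeff_of_ne p hab.ne, cartanEig,
        if_neg hab.ne, koszul_comm (p b)]
      linear_combination (norm := module) hk • tens a b
    · rw [koszul_self] at hk ⊢
      rw [if_neg (lt_irrefl a), diagCoeff_self, swapCoeff_self, cartanEig, if_pos rfl]
      linear_combination (norm := module) (q ^ sgn p a * hk) • tens a a
    · rw [if_pos hab, diagCoeff_of_gt p hab, swapCoeff_of_ne p hab.ne', cartanEig, cartanEig,
        if_neg hab.ne, if_neg hab.ne', koszul_comm (p b)]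
      linear_combination (norm := module) hk • tens a b
  · rw [← LinearMap.comp_assoc, flip_comp_flip, LinearMap.id_comp]
    exact braiding_comulAct p g

theorem existsUnique_isRMatrix : ∃! R, (natural p).IsRMatrix (natural p) R := by
  refine ⟨_, isRMatrix_flip_comp_braiding p, fun R hR => ?_⟩
  rw [← flip_comp_eq_braiding p hR, ← LinearMap.comp_assoc, flip_comp_flip, LinearMap.id_comp]

end RMatrix

end QGL

/-! ### Assembly of the three statements. -/

theorem mainTheorem9 (m n : ℕ) (σ : Fin (m + n) ≃ Fin m ⊕ Fin n) :
    -- the operator `R` of the `R`-matrix on `V_q ⊗ V_q` exists and is unique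
    (∃! R, (QGL.natMod σ).IsRMatrix (QGL.natMod σ) R) ∧
    ∀ R, (QGL.natMod σ).IsRMatrix (QGL.natMod σ) R →
      -- the braiding `c = τ ∘ R`
      ∀ c : Module.End QGL.F (TensorProduct QGL.F (QGL.NatSpace m n) (QGL.NatSpace m n)),
      c = (QGL.natMod σ).flip (QGL.natMod σ) ∘ₗ R →
      -- `c = q P[s] - q⁻¹ P[a]` for the projections to the simple summands `L_q(s)` and `L_q(a)`
      (∃ Ps Pa : Module.End QGL.F (TensorProduct QGL.F (QGL.NatSpace m n) (QGL.NatSpace m n)),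
        Ps * Ps = Ps ∧ Pa * Pa = Pa ∧ Ps * Pa = 0 ∧ Pa * Ps = 0 ∧ Ps + Pa = 1 ∧
        (∀ g, Ps * (QGL.natMod σ).comulAct (QGL.natMod σ) g =
          (QGL.natMod σ).comulAct (QGL.natMod σ) g * Ps) ∧
        (∀ g, Pa * (QGL.natMod σ).comulAct (QGL.natMod σ) g =
          (QGL.natMod σ).comulAct (QGL.natMod σ) g * Pa) ∧
        (∀ L, (QGL.natMod σ).IsStable (QGL.natMod σ) L → L ≤ LinearMap.range Ps →
          L = ⊥ ∨ L = LinearMap.range Ps) ∧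
        (∀ L, (QGL.natMod σ).IsStable (QGL.natMod σ) L → L ≤ LinearMap.range Pa →
          L = ⊥ ∨ L = LinearMap.range Pa) ∧
        Module.finrank QGL.F (LinearMap.range Ps) = (m + 1).choose 2 + m * n + n.choose 2 ∧
        Module.finrank QGL.F (LinearMap.range Pa) = m.choose 2 + m * n + (n + 1).choose 2 ∧
        c = QGL.q • Ps - QGL.q⁻¹ • Pa) ∧
      (c - QGL.q • 1) * (c + QGL.q⁻¹ • 1) = 0 ∧
      -- the representation `ν_r` of `B_r` given by the braiding factors through `H_r(q)`
      ∀ r : ℕ, ∃ ν : Representation QGL.F (QGL.BraidGroup r)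
          (PiTensorProduct QGL.F (fun _ : Fin r => QGL.NatSpace m n)),
        (∀ i, ν (QGL.braidGen i) = QGL.braidOp c i) ∧
        ∃ νH : QGL.Hecke r →ₐ[QGL.F] Module.End QGL.F
            (PiTensorProduct QGL.F (fun _ : Fin r => QGL.NatSpace m n)),
          ∀ x, νH (QGL.toHecke r x) = ν.asAlgebraHom x := by
  have hs : QGL.IsHeckeEig QGL.q := Or.inl rfl
  have ha : QGL.IsHeckeEig (-QGL.q⁻¹) := Or.inr rfl
  refine ⟨QGL.existsUnique_isRMatrix (QGL.parity σ), fun R hR c hc => ?_⟩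
  have hcb : c = QGL.braiding (QGL.parity σ) :=
    hc.trans (QGL.flip_comp_eq_braiding (QGL.parity σ) hR)
  subst hcb
  clear hc
  have h2 : (QGL.q + QGL.q⁻¹)⁻¹ * (QGL.q + QGL.q⁻¹) = 1 := inv_mul_cancel₀ QGL.q_add_inv_ne_zero
  -- For `l = -q⁻¹` the normalising factor `l + l⁻¹` is `-(q + q⁻¹)`, so the two projections have
  -- opposite denominators and the `c` terms cancel in their sum.
  have h3 : (-QGL.q⁻¹ - QGL.q)⁻¹ = -(QGL.q + QGL.q⁻¹)⁻¹ := by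
    apply inv_eq_of_mul_eq_one_right
    linear_combination h2
  have happ : ∀ (l : QGL.F) x, QGL.eigenProj (QGL.parity σ) l x =
      (l + l⁻¹)⁻¹ • (QGL.braiding (QGL.parity σ) x + l⁻¹ • x) := fun l x => rfl
  have happ' : ∀ x, QGL.eigenProj (QGL.parity σ) (-QGL.q⁻¹) x =
      (-(QGL.q + QGL.q⁻¹)⁻¹) • (QGL.braiding (QGL.parity σ) x + (-QGL.q) • x) := fun x => by
    rw [happ, QGL.neg_q_inv_inv, ← sub_eq_add_neg, h3]
  have hsum : QGL.eigenProj (QGL.parity σ) QGL.q + QGL.eigenProj (QGL.parity σ) (-QGL.q⁻¹) = 1 := by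
    refine LinearMap.ext fun x => ?_
    rw [LinearMap.add_apply, happ, happ', Module.End.one_apply]
    linear_combination (norm := module) h2 • x
  have hPs := QGL.eigenProj_mul_self (QGL.parity σ) hs
  have hPa := QGL.eigenProj_mul_self (QGL.parity σ) ha
  have hsq := QGL.braiding_mul_self (QGL.parity σ)
  have hqq : QGL.q * QGL.q⁻¹ = 1 := mul_inv_cancel₀ QGL.q_ne_zero
  refine ⟨⟨QGL.eigenProj (QGL.parity σ) QGL.q, QGL.eigenProj (QGL.parity σ) (-QGL.q⁻¹), hPs, hPa,
    ?_, ?_, hsum, QGL.eigenProj_comulAct _ _, QGL.eigenProj_comulAct _ _,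
    QGL.eigenProj_range_simple _ hs, QGL.eigenProj_range_simple _ ha,
    QGL.finrank_range_symm σ, QGL.finrank_range_alt σ, ?_⟩, ?_,
    fun r => ⟨QGL.braidRep (QGL.parity σ) r, QGL.braidRep_braidGen _,
      QGL.exists_hecke_hom (QGL.parity σ) r⟩⟩
  -- Orthogonality follows by applying `P[s] + P[a] = 1` to a vector already in the image of one
  -- idempotent.
  · refine LinearMap.ext fun x => ?_
    have h4 := LinearMap.congr_fun hsum (QGL.eigenProj (QGL.parity σ) (-QGL.q⁻¹) x)
    have h5 := LinearMap.congr_fun hPa x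
    rw [Module.End.mul_apply] at h5
    rw [LinearMap.add_apply, h5, Module.End.one_apply, add_eq_right] at h4
    exact h4
  · refine LinearMap.ext fun x => ?_
    have h4 := LinearMap.congr_fun hsum (QGL.eigenProj (QGL.parity σ) QGL.q x)
    have h5 := LinearMap.congr_fun hPs x
    rw [Module.End.mul_apply] at h5
    rw [LinearMap.add_apply, h5, Module.End.one_apply, add_eq_left] at h4
    exact h4
  · refine LinearMap.ext fun x => ?_
    rw [LinearMap.sub_apply, LinearMap.smul_apply, LinearMap.smul_apply, happ, happ']
    linear_combination (norm := module) -(h2 • QGL.braiding (QGL.parity σ) x)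
  · refine LinearMap.ext fun x => ?_
    have h4 := LinearMap.congr_fun hsq x
    simp only [Module.End.mul_apply, LinearMap.add_apply, LinearMap.sub_apply,
      LinearMap.smul_apply, Module.End.one_apply, map_add, map_smul, LinearMap.zero_apply] at h4 ⊢
    rw [h4]
    linear_combination (norm := module) -(hqq • x)
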